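/- Let $M$ be a smooth manifold (Hausdorff, second countable, finite-dimensional), let $\mathbb{T}M=TM\oplus T^*M$ be its generalized tangent bundle with anchor $\pi$, tautological inner product $\langle X+\alpha,Y+\beta\rangle=\tfrac12(\alpha(Y)+\beta(X))$ and Courant--Dorfman bracket $[\![X+\alpha,Y+\beta]\!]=[X,Y]+\mathcal L_X\beta-i_Y d\alpha$. Let $N$ be a natural number and $\varepsilon\in\{\pm1\}^N$. A commuting family of signature $\varepsilon$ on $M$ is an $N$-tuple $\phi=(\phi_1,\dots,\phi_N)$ of pairwise commuting smooth sections of $\operatorname{End}(\mathbb{T}M)$ with $\phi_i^*=\varepsilon_i\phi_i$, the adjoint being taken with respect to $\langle\cdot,\cdot\rangle$. For $P=\sum a_{I,J,K}x^Iy^Jz^K\in\mathcal R=\mathbb R[x_1,\dots,x_N,y_1,\dots,y_N,z_1,\dots,z_N]$ put $$(P\bullet_\phi\tau_C)(\mathbf a,\mathbf b,\mathbf c)=\sum a_{I,J,K}\,\langle[\![\phi^I\mathbf a,\phi^J\mathbf b]\!],\phi^K\mathbf c\rangle,\qquad \mathbf a,\mathbf b,\mathbf c\in\Gamma(\mathbb{T}M).$$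 Let $\mathcal I_\varepsilon$ be the set of all $P\in\mathcal R$ such that $P\bullet_\psi\tau_C$ is $C^\infty$-linear in each argument for every commuting family $\psi$ of signature $\varepsilon$ on every smooth manifold. The family $\phi$ is called uniformly integrable if $P\bullet_\phi\tau_C=0$ for all $P\in\mathcal I_\varepsilon$. It is called semisimple if for each $i$ there is a finite set $\Sigma_i\subset\mathbb C$ such that $\mathbb{T}M\otimes\mathbb C=\bigoplus_{z\in\Sigma_i}\ker(\phi_i-z)$. For $\lambda\in\mathbb C^N$ put $L_\lambda=\bigcap_{i}\ker(\phi_i-\lambda_i)\subseteq\mathbb{T}M\otimes\mathbb C$, and extend the bracket complex bilinearly to sections of $\mathbb{T}M\otimes\mathbb C$. Theorem. A semisimple commuting family $\phi$ of signature $\varepsilon$ on $M$ is uniformly integrable if and only if for all $\lambda,\mu\in\mathbb C^N$: 1) $\|\lambda-\operatorname{diag}(\varepsilon)\mu\|\cdot[\![\Gamma(L_\lambda),\Gamma(L_\mu)]\!]\subseteq\Gamma(L_\lambda+L_\mu)$; and 2) $[\![\Gamma(L_\lambda),\Gamma(L_\mu)]\!]\subseteq\Gamma(L_\lambda\circledast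 L_\mu)$, where $L_\lambda\circledast L_\mu$ is the Whitney sum of all $L_\xi$, $\xi\in\mathbb C^N$, such that $$\det\begin{pmatrix}\lambda_i&\lambda_j&1\\ \mu_i&\mu_j&1\\ \xi_i&\xi_j&1\end{pmatrix}=0$$ for all indices $i,j$ with $\varepsilon_i=\varepsilon_j=1$. -/

import Mathlib

open scoped Manifold ContDiff Bundle TensorProduct

universe u

noncomputable section

namespace GenTangent

section Bundles

variable (E : Type u) [NormedAddCommGroup E] [NormedSpace ℝ E]
  (M : Type u) [TopologicalSpace M] [ChartedSpace E M]

/-- The cotangent bundle `T^*M`, as the bundle of homomorphisms from the tangent bundle to the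
trivial line bundle. -/
abbrev Cotangent (x : M) : Type u :=
  TangentSpace 𝓘(ℝ, E) x →L[ℝ] Bundle.Trivial M ℝ x

/-- The model fibre of the generalized tangent bundle. -/
abbrev GFib : Type u := E × (E →L[ℝ] ℝ)

/-- The generalized tangent bundle `𝕋M = TM ⊕ T^*M` (a Whitney sum). -/
def GTan : M → Type u :=
  (fun x : M => TangentSpace 𝓘(ℝ, E) x) ×ᵇ (fun x : M => Cotangent E M x)

instance (x : M) : AddCommGroup (GTan E M x) :=
  inferInstanceAs (AddCommGroup (TangentSpace 𝓘(ℝ, E) x × Cotangent E M x))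

instance (x : M) : Module ℝ (GTan E M x) :=
  inferInstanceAs (Module ℝ (TangentSpace 𝓘(ℝ, E) x × Cotangent E M x))

instance (x : M) : TopologicalSpace (GTan E M x) :=
  inferInstanceAs (TopologicalSpace (TangentSpace 𝓘(ℝ, E) x × Cotangent E M x))

instance (x : M) : IsTopologicalAddGroup (GTan E M x) :=
  inferInstanceAs (IsTopologicalAddGroup (TangentSpace 𝓘(ℝ, E) x × Cotangent E M x))

instance (x : M) : ContinuousSMul ℝ (GTan E M x) :=
  inferInstanceAs (ContinuousSMul ℝ (TangentSpace 𝓘(ℝ, E) x × Cotangent E M x))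

section Instances

variable [IsManifold 𝓘(ℝ, E) ∞ M]

instance : TopologicalSpace (Bundle.TotalSpace (GFib E) (GTan E M)) :=
  inferInstanceAs (TopologicalSpace (Bundle.TotalSpace (E × (E →L[ℝ] ℝ))
    ((fun x : M => TangentSpace 𝓘(ℝ, E) x) ×ᵇ (fun x : M => Cotangent E M x))))

instance : FiberBundle (GFib E) (GTan E M) :=
  inferInstanceAs (FiberBundle (E × (E →L[ℝ] ℝ))
    ((fun x : M => TangentSpace 𝓘(ℝ, E) x) ×ᵇ (fun x : M => Cotangent E M x)))

instance : VectorBundle ℝ (GFib E) (GTan E M) :=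
  inferInstanceAs (VectorBundle ℝ (E × (E →L[ℝ] ℝ))
    ((fun x : M => TangentSpace 𝓘(ℝ, E) x) ×ᵇ (fun x : M => Cotangent E M x)))

instance : ContMDiffVectorBundle ∞ (GFib E) (GTan E M) 𝓘(ℝ, E) :=
  inferInstanceAs (ContMDiffVectorBundle ∞ (E × (E →L[ℝ] ℝ))
    ((fun x : M => TangentSpace 𝓘(ℝ, E) x) ×ᵇ (fun x : M => Cotangent E M x)) 𝓘(ℝ, E))

end Instances

variable [IsManifold 𝓘(ℝ, E) ∞ M]

/-- `Γ(𝕋M)`: the smooth sections of the generalized tangent bundle. -/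
abbrev GSec : Type u := Cₛ^∞⟮𝓘(ℝ, E); GFib E, GTan E M⟯

/-- `Γ(End 𝕋M)`: the smooth sections of the bundle of endomorphisms of the generalized tangent
bundle. -/
abbrev GEnd : Type u :=
  Cₛ^∞⟮𝓘(ℝ, E); GFib E →L[ℝ] GFib E, (fun x : M => GTan E M x →L[ℝ] GTan E M x)⟯

end Bundles

section Structures

variable {E : Type u} [NormedAddCommGroup E] [NormedSpace ℝ E]
  {M : Type u} [TopologicalSpace M] [ChartedSpace E M]

/-- The tangent part `X` of `X + α`, i.e. the anchor map. -/
def GTan.vec {x : M} (u : GTan E M x) : TangentSpace 𝓘(ℝ, E) x :=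
  Prod.fst (show TangentSpace 𝓘(ℝ, E) x × Cotangent E M x from u)

/-- The cotangent part `α` of `X + α`. -/
def GTan.form {x : M} (u : GTan E M x) : Cotangent E M x :=
  Prod.snd (show TangentSpace 𝓘(ℝ, E) x × Cotangent E M x from u)

/-- The element `X + α` of the fibre at `x`. -/
def GTan.mk {x : M} (X : TangentSpace 𝓘(ℝ, E) x) (α : Cotangent E M x) : GTan E M x :=
  show TangentSpace 𝓘(ℝ, E) x × Cotangent E M x from (X, α)

/-- The tautological inner product `⟨X + α, Y + β⟩ = (α(Y) + β(X)) / 2` on the fibre at `x`. -/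
def pairing {x : M} (u v : GTan E M x) : ℝ :=
  ((u.form v.vec : ℝ) + (v.form u.vec : ℝ)) / 2

/-- A vector field read in the preferred chart at `x` (its pull-back by the inverse chart). -/
def vecInChart (x : M) (X : ∀ p : M, TangentSpace 𝓘(ℝ, E) p) : E → E :=
  VectorField.mpullback 𝓘(ℝ, E) 𝓘(ℝ, E) (extChartAt 𝓘(ℝ, E) x).symm X

/-- A one-form read in the preferred chart at `x` (its pull-back by the inverse chart). -/
def formInChart (x : M) (α : ∀ p : M, Cotangent E M p) : E → (E →L[ℝ] ℝ) := fun y =>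
  ContinuousLinearMap.comp (α ((extChartAt 𝓘(ℝ, E) x).symm y) : E →L[ℝ] ℝ)
    (mfderiv 𝓘(ℝ, E) 𝓘(ℝ, E) (extChartAt 𝓘(ℝ, E) x).symm y : E →L[ℝ] E)

/-- The Lie derivative of a one-form on `E`: `(L_X β)_y(v) = (D_{X} β)_y(v) + β_y(D_v X)`. -/
def lieDerivForm (X : E → E) (β : E → (E →L[ℝ] ℝ)) (y : E) : E →L[ℝ] ℝ :=
  fderiv ℝ β y (X y) + (β y).comp (fderiv ℝ X y)

/-- The contraction `i_Y dα` on `E`: `(i_Y dα)_y(v) = (D_{Y} α)_y(v) - (D_v α)_y(Y)`. -/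
def contrExtDeriv (Y : E → E) (α : E → (E →L[ℝ] ℝ)) (y : E) : E →L[ℝ] ℝ :=
  fderiv ℝ α y (Y y) - (fderiv ℝ α y).flip (Y y)

/-- The cotangent part `L_X β - i_Y dα` of the Courant-Dorfman bracket at `x`, computed in the
preferred chart at `x` and carried back to the cotangent space at `x`. -/
def formBracket (X Y : ∀ p : M, TangentSpace 𝓘(ℝ, E) p) (α β : ∀ p : M, Cotangent E M p)
    (x : M) : Cotangent E M x :=
  ContinuousLinearMap.comp
    (lieDerivForm (vecInChart x X) (formInChart x β) (extChartAt 𝓘(ℝ, E) x x)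
      - contrExtDeriv (vecInChart x Y) (formInChart x α) (extChartAt 𝓘(ℝ, E) x x) : E →L[ℝ] ℝ)
    (mfderiv 𝓘(ℝ, E) 𝓘(ℝ, E) (extChartAt 𝓘(ℝ, E) x) x : E →L[ℝ] E)

variable [IsManifold 𝓘(ℝ, E) ∞ M]

/-- The Courant-Dorfman bracket `⟦X + α, Y + β⟧ = [X, Y] + L_X β - i_Y dα` of two smooth sections
of the generalized tangent bundle, as a section of that bundle. The formula is invariant under
changes of charts, so that the section obtained is automatically smooth. -/
def bracket (a b : GSec E M) (x : M) : GTan E M x :=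
  GTan.mk (VectorField.mlieBracket 𝓘(ℝ, E) (fun p => (a p).vec) (fun p => (b p).vec) x)
    (formBracket (fun p => (a p).vec) (fun p => (b p).vec)
      (fun p => (a p).form) (fun p => (b p).form) x)

/-- The product of a smooth function with a smooth section of the generalized tangent bundle. -/
def fsmul (f : C^∞⟮𝓘(ℝ, E), M; ℝ⟯) (a : GSec E M) : GSec E M :=
  ⟨fun x => f x • a x, f.contMDiff.smul_section a.contMDiff⟩

/-- The action of a smooth endomorphism of the generalized tangent bundle on smooth sections. -/
def act (A : GEnd E M) : Module.End ℝ (GSec E M) where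
  toFun a := ⟨fun x => A x (a x), A.contMDiff.clm_bundle_apply a.contMDiff⟩
  map_add' a b := ContMDiffSection.ext fun x => (A x).map_add (a x) (b x)
  map_smul' r a := ContMDiffSection.ext fun x => (A x).map_smul r (a x)

end Structures

section Families

variable (E : Type u) [NormedAddCommGroup E] [NormedSpace ℝ E]
  (M : Type u) [TopologicalSpace M] [ChartedSpace E M] [IsManifold 𝓘(ℝ, E) ∞ M]

/-- A commuting family of signature `ε`: an `N`-tuple of pairwise commuting smooth endomorphisms
of the generalized tangent bundle with `φᵢ^* = εᵢ φᵢ` for the tautological inner product. -/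
structure CommutingFamily (N : ℕ) (ε : Fin N → ℤˣ) where
  toFun : Fin N → GEnd E M
  adjoint : ∀ (i : Fin N) (x : M) (u v : GTan E M x),
    pairing (toFun i x u) v = ((ε i : ℤ) : ℝ) * pairing u (toFun i x v)
  comm : ∀ (i j : Fin N) (x : M) (u : GTan E M x),
    toFun i x (toFun j x u) = toFun j x (toFun i x u)

/-- Forms taking three sections of the generalized tangent bundle to a function on `M`. -/
abbrev TriForm : Type u := GSec E M → GSec E M → GSec E M → M → ℝ

variable {E M}

/-- The Courant element `τ_C(a, b, c) = ⟨⟦a, b⟧, c⟩`. -/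
def courantElement : TriForm E M := fun a b c x => pairing (bracket a b x) (c x)

/-- Linearity over the smooth functions in each of the three arguments. -/
structure IsTensor (τ : TriForm E M) : Prop where
  add_left : ∀ a a' b c, τ (a + a') b c = τ a b c + τ a' b c
  add_mid : ∀ a b b' c, τ a (b + b') c = τ a b c + τ a b' c
  add_right : ∀ a b c c', τ a b (c + c') = τ a b c + τ a b c'
  smul_left : ∀ (f : C^∞⟮𝓘(ℝ, E), M; ℝ⟯) a b c x, τ (fsmul f a) b c x = f x * τ a b c x
  smul_mid : ∀ (f : C^∞⟮𝓘(ℝ, E), M; ℝ⟯) a b c x, τ a (fsmul f b) c x = f x * τ a b c x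
  smul_right : ∀ (f : C^∞⟮𝓘(ℝ, E), M; ℝ⟯) a b c x, τ a b (fsmul f c) x = f x * τ a b c x

/-- The ring `ℝ[x₁, …, x_N, y₁, …, y_N, z₁, …, z_N]`: the variables `xᵢ`, `yᵢ`, `zᵢ` are indexed by
`(0, i)`, `(1, i)`, `(2, i)`. -/
abbrev PolyRing (N : ℕ) : Type := MvPolynomial (Fin 3 × Fin N) ℝ

variable {N : ℕ} {ε : Fin N → ℤˣ}

/-- The operator `φ^I = φ₁^{I₁} ⋯ φ_N^{I_N}` on sections. -/
def CommutingFamily.pow (φ : CommutingFamily E M N ε) (I : Fin N → ℕ) :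
    Module.End ℝ (GSec E M) :=
  (List.ofFn fun i => act (φ.toFun i) ^ I i).prod

/-- The polynomial action: for `P = ∑ r_{I,J,K} x^I y^J z^K`,
`(P • τ)(a, b, c) = ∑ r_{I,J,K} τ(φ^I a, φ^J b, φ^K c)`. -/
def CommutingFamily.polyAct (φ : CommutingFamily E M N ε) (P : PolyRing N) (τ : TriForm E M) :
    TriForm E M := fun a b c x =>
  ∑ d ∈ P.support, P.coeff d * τ (φ.pow (fun i => d (0, i)) a) (φ.pow (fun i => d (1, i)) b)
    (φ.pow (fun i => d (2, i)) c) x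

/-- The ideal `Z(φ)` of the polynomials `P` for which `P • τ_C` vanishes identically. -/
def CommutingFamily.vanishing (φ : CommutingFamily E M N ε) : Set (PolyRing N) :=
  {P | ∀ a b c x, φ.polyAct P courantElement a b c x = 0}

/-- The ideal `I_ε` of the universally tensorial polynomials of signature `ε`: those `P` for which
`P • τ_C` is a tensor for every commuting family of signature `ε` on every smooth manifold. -/
def universallyTensorial (N : ℕ) (ε : Fin N → ℤˣ) : Set (PolyRing N) :=
  {P | ∀ (E : Type u) [NormedAddCommGroup E] [NormedSpace ℝ E] [FiniteDimensional ℝ E]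
      (M : Type u) [TopologicalSpace M] [T2Space M] [SecondCountableTopology M]
      [ChartedSpace E M] [IsManifold 𝓘(ℝ, E) ∞ M] (φ : CommutingFamily E M N ε),
      IsTensor (φ.polyAct P courantElement)}

/-- Uniform integrability: `I_ε ⊆ Z(φ)`. -/
def CommutingFamily.UniformlyIntegrable (φ : CommutingFamily E M N ε) : Prop :=
  universallyTensorial.{u} N ε ⊆ φ.vanishing

end Families

section Complexification

variable (E : Type u) [NormedAddCommGroup E] [NormedSpace ℝ E]
  (M : Type u) [TopologicalSpace M] [ChartedSpace E M]

/-- The complexified generalized tangent bundle `𝕋M ⊗ ℂ`. -/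
abbrev CGTan (x : M) : Type u := ℂ ⊗[ℝ] GTan E M x

variable [IsManifold 𝓘(ℝ, E) ∞ M]

/-- Smooth sections of the complexified generalized tangent bundle, given by their real and
imaginary parts. -/
structure CSec where
  re : GSec E M
  im : GSec E M

variable {E M}

/-- The value `re + √-1 im` of a complex section at a point. -/
def CSec.eval (s : CSec E M) (x : M) : CGTan E M x :=
  (1 : ℂ) ⊗ₜ[ℝ] s.re x + Complex.I ⊗ₜ[ℝ] s.im x

/-- The complex bilinear extension of the Courant-Dorfman bracket. -/
def cbracket (s t : CSec E M) (x : M) : CGTan E M x :=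
  (1 : ℂ) ⊗ₜ[ℝ] (bracket s.re t.re x - bracket s.im t.im x)
    + Complex.I ⊗ₜ[ℝ] (bracket s.re t.im x + bracket s.im t.re x)

/-- `Γ(L)`, for a family `L` of subspaces of the fibres of `𝕋M ⊗ ℂ`. -/
def sectionsOf (L : ∀ x : M, Submodule ℂ (CGTan E M x)) : Set (CSec E M) :=
  {s | ∀ x, s.eval x ∈ L x}

variable {N : ℕ} {ε : Fin N → ℤˣ}

/-- The complexification of `φᵢ` at the point `x`. -/
def CommutingFamily.complexify (φ : CommutingFamily E M N ε) (i : Fin N) (x : M) :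
    Module.End ℂ (CGTan E M x) :=
  (φ.toFun i x : GTan E M x →ₗ[ℝ] GTan E M x).baseChange ℂ

/-- Semisimplicity: for every `i` there is a finite set `S` of complex numbers such that
`𝕋M ⊗ ℂ` is the direct sum of the eigenbundles `ker(φᵢ - z)`, `z ∈ S`. -/
def CommutingFamily.IsSemisimple (φ : CommutingFamily E M N ε) : Prop :=
  ∀ i, ∃ S : Finset ℂ, ∀ x : M,
    DirectSum.IsInternal fun z : S => Module.End.eigenspace (φ.complexify i x) (z : ℂ)

/-- The joint eigenbundle `L_l = ⋂ᵢ ker(φᵢ - lᵢ)`. -/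
def CommutingFamily.jointEigen (φ : CommutingFamily E M N ε) (l : Fin N → ℂ) (x : M) :
    Submodule ℂ (CGTan E M x) :=
  ⨅ i, Module.End.eigenspace (φ.complexify i x) (l i)

/-- The Whitney sum `L_l ⊛ L_m` of all `L_k` such that `det (lᵢ lⱼ 1; mᵢ mⱼ 1; kᵢ kⱼ 1) = 0` for
all `i`, `j` with `εᵢ = εⱼ = 1`. -/
def CommutingFamily.detSum (φ : CommutingFamily E M N ε) (l m : Fin N → ℂ) (x : M) :
    Submodule ℂ (CGTan E M x) :=
  ⨆ k : {k : Fin N → ℂ // ∀ i j, ε i = 1 → ε j = 1 →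
    (!![l i, l j, 1; m i, m j, 1; k i, k j, 1] : Matrix (Fin 3) (Fin 3) ℂ).det = 0},
    φ.jointEigen k.1 x

end Complexification

end GenTangent

end

/-!
The polynomials that act tensorially for every commuting family of signature `ε` can be described
explicitly. By the Leibniz rules of the Courant-Dorfman bracket (`bracket_fsmul_left`,
`bracket_fsmul_right`), the failure of `P • τ_C` to be linear over the functions is a sum of terms
`(π(a) f) ⟨b, c⟩`, `(π(b) f) ⟨a, c⟩` and `(π(c) f) ⟨a, b⟩`, with monomials in `φ` applied to the
three sections. By the adjunction relation these terms vanish if `P(x, εz, z)`, `P(εz, y, z)` and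
`P(x, εx, z)` are zero, and constant diagonal families on the plane show that this is also necessary
(`eval_eq_zero_of_mem_universallyTensorial`). Sufficiency is only needed for the cubics
`(xᵢ - εᵢ yᵢ) (yⱼ - εⱼ zⱼ) (z_k - ε_k x_k)` (`crossCubic_mem_universallyTensorial`).

If `φ` is semisimple, the projections onto the joint eigenbundles are polynomials in `φ` with
constant coefficients, so that complex sections decompose smoothly into sections of the `L_λ`
(`IsSemisimple.iSup_eigenspace_ops`), and on sections `a`, `b`, `c` of `L_λ`, `L_μ`, `L_ν` one has
`(P • τ_C)(a, b, c) = P(λ, μ, ν) ⟨⟦a, b⟧, c⟩` (`complexPolyAct_eigenvectors`). Hence `φ` is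
uniformly integrable if and only if `⟨⟦a, b⟧, c⟩ = 0` whenever `λ ≠ εμ`, `μ ≠ εν` and `ν ≠ ελ`: in
that case one of the cubics is nonzero at `(λ, μ, ν)`, and otherwise every universally tensorial
polynomial vanishes there. Since `L_ξ` and `L_ν` are orthogonal unless `ξ = εν` and the pairing is
nondegenerate, this says that `⟦a, b⟧` takes values in `L_λ + L_μ` whenever `λ ≠ εμ`, which is the
first condition.

The second condition follows from the first one. If `λ ≠ εμ`, then `L_λ + L_μ` is contained in
`L_λ ⊛ L_μ`, because the determinants vanish for `ξ = λ` and `ξ = μ`. If `λ = εμ`, the first two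
rows of the determinants agree, and `L_λ ⊛ L_μ` is the whole bundle.
-/

noncomputable section

namespace GenTangent

/-! ### Joint eigenspaces of commuting endomorphisms -/

section JointEigenspaces

variable {K V : Type*} [Field K] [AddCommGroup V] [Module K V]

open Polynomial in
/-- If `f` is annihilated by a product of distinct linear factors, every `f`-invariant submodule is
spanned by its intersections with the eigenspaces of `f`. The components of a vector are obtained
by applying to `f` the Lagrange basis polynomials of the roots; no finite-dimensionality is
involved. -/
theorem le_iSup_inf_eigenspace {f : Module.End K V} {S : Finset K}
    (hf : aeval f (∏ z ∈ S, (X - C z)) = 0) {W : Submodule K V} (hW : ∀ v ∈ W, f v ∈ W) :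
    W ≤ ⨆ z, W ⊓ Module.End.eigenspace f z := by
  classical
  intro v hv
  rcases S.eq_empty_or_nonempty with rfl | hS
  · have : v = 0 := by simpa using congrArg (fun g : Module.End K V => g v) hf
    simp [this]
  have hsum : v = ∑ z ∈ S, aeval f (Lagrange.basis S id z) v := by
    rw [← LinearMap.sum_apply, ← map_sum, Lagrange.sum_basis Function.injective_id.injOn hS]
    simp
  rw [hsum]
  refine Submodule.sum_mem _ fun z hz => Submodule.mem_iSup_of_mem z ⟨?_, ?_⟩
  · have hpow : ∀ n : ℕ, (f ^ n) v ∈ W := fun n => by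
      induction n with
      | zero => simpa using hv
      | succ n ih => rw [pow_succ']; exact hW _ ih
    rw [aeval_eq_sum_range, LinearMap.sum_apply]
    exact Submodule.sum_mem _ fun n _ => W.smul_mem _ (hpow n)
  · have hdvd : (∏ z ∈ S, (X - C z)) ∣ (X - C z) * Lagrange.basis S id z := by
      rw [← Finset.mul_prod_erase S _ hz]
      refine mul_dvd_mul_left _ ?_
      rw [Lagrange.basis]
      refine Finset.prod_dvd_prod_of_dvd _ _ fun w _ => ?_
      rw [Lagrange.basisDivisor]
      exact dvd_mul_left _ _
    obtain ⟨q, hq⟩ := hdvd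
    have h0 : aeval f ((X - C z) * Lagrange.basis S id z) = 0 := by
      rw [hq, map_mul, hf, zero_mul]
    have h1 := congrArg (fun g : Module.End K V => g v) h0
    rw [SetLike.mem_coe, Module.End.mem_eigenspace_iff]
    simpa [sub_eq_zero, Module.algebraMap_end_apply] using h1

theorem iSup_iInf_eigenspace_eq_top {ι : Type*} [Finite ι] {f : ι → Module.End K V}
    (hcomm : ∀ i j v, f i (f j v) = f j (f i v))
    (hf : ∀ i, ∃ S : Finset K,
      Polynomial.aeval (f i) (∏ z ∈ S, (Polynomial.X - Polynomial.C z)) = 0) :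
    ⨆ χ : ι → K, ⨅ i, Module.End.eigenspace (f i) (χ i) = ⊤ := by
  classical
  have := Fintype.ofFinite ι
  suffices h : ∀ A : Finset ι, ⨆ χ : ι → K, ⨅ i ∈ A, Module.End.eigenspace (f i) (χ i) = ⊤ by
    simpa using h Finset.univ
  intro A
  induction A using Finset.induction_on with
  | empty => simp
  | insert j A hj ih =>
    rw [eq_top_iff, ← ih]
    refine iSup_le fun χ => ?_
    obtain ⟨S, hS⟩ := hf j
    refine (le_iSup_inf_eigenspace hS fun v hv => ?_).trans (iSup_le fun z => ?_)
    · simp only [Submodule.mem_iInf, Module.End.mem_eigenspace_iff] at hv ⊢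
      intro i hi
      rw [hcomm, hv i hi, map_smul]
    · refine le_iSup_of_le (Function.update χ j z) ?_
      rw [Finset.iInf_insert]
      refine le_inf (by simp) (inf_le_left.trans (iInf₂_mono fun i hi => ?_))
      rw [Function.update_of_ne (by rintro rfl; exact hj hi)]

theorem aeval_prod_X_sub_C_of_isInternal {f : Module.End K V} {S : Finset K} [DecidableEq S]
    (h : DirectSum.IsInternal fun z : S => Module.End.eigenspace f (z : K)) :
    Polynomial.aeval f (∏ z ∈ S, (Polynomial.X - Polynomial.C z)) = 0 := by
  classical
  have key : ⨆ z : S, Module.End.eigenspace f (z : K) ≤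
      LinearMap.ker (Polynomial.aeval f (∏ z ∈ S, (Polynomial.X - Polynomial.C z))) := by
    refine iSup_le fun z v hv => ?_
    rw [LinearMap.mem_ker, ← Finset.mul_prod_erase S _ z.2, mul_comm, map_mul,
      Module.End.mul_apply]
    rw [Module.End.mem_eigenspace_iff] at hv
    simp [hv, Module.algebraMap_end_apply]
  rw [h.submodule_iSup_eq_top, top_le_iff] at key
  exact LinearMap.ker_eq_top.1 key

end JointEigenspaces

/-! ### Sums over the monomials of a polynomial -/

section MonomialSums

variable {σ R : Type*} [CommSemiring R]

/-- The sum `∑ r_d g(d)` over the monomials of `P = ∑ r_d X^d`. -/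
def monomialSum (g : (σ →₀ ℕ) → R) (P : MvPolynomial σ R) : R :=
  ∑ d ∈ P.support, P.coeff d * g d

theorem monomialSum_add (g : (σ →₀ ℕ) → R) (P Q : MvPolynomial σ R) :
    monomialSum g (P + Q) = monomialSum g P + monomialSum g Q := by
  classical
  have key : ∀ T : MvPolynomial σ R, T.support ⊆ P.support ∪ Q.support →
      monomialSum g T = ∑ d ∈ P.support ∪ Q.support, T.coeff d * g d := fun T hT =>
    Finset.sum_subset hT fun d _ hd => by rw [MvPolynomial.notMem_support_iff.1 hd, zero_mul]
  rw [key _ MvPolynomial.support_add, key P Finset.subset_union_left,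
    key Q Finset.subset_union_right, ← Finset.sum_add_distrib]
  simp only [MvPolynomial.coeff_add, add_mul]

theorem monomialSum_C_mul (g : (σ →₀ ℕ) → R) (r : R) (P : MvPolynomial σ R) :
    monomialSum g (MvPolynomial.C r * P) = r * monomialSum g P := by
  have key : monomialSum g (MvPolynomial.C r * P) =
      ∑ d ∈ P.support, (MvPolynomial.C r * P).coeff d * g d :=
    Finset.sum_subset (fun d hd => by
      rw [MvPolynomial.mem_support_iff, MvPolynomial.coeff_C_mul] at hd
      rw [MvPolynomial.mem_support_iff]
      exact right_ne_zero_of_mul hd) fun d _ hd => by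
        rw [MvPolynomial.notMem_support_iff.1 hd, zero_mul]
  rw [key, monomialSum, Finset.mul_sum]
  simp only [MvPolynomial.coeff_C_mul, mul_assoc]

theorem monomialSum_X_mul (g : (σ →₀ ℕ) → R) (v : σ) (P : MvPolynomial σ R) :
    monomialSum g (MvPolynomial.X v * P) =
      monomialSum (fun d => g (Finsupp.single v 1 + d)) P := by
  rw [monomialSum, MvPolynomial.support_X_mul, Finset.sum_map]
  simp [MvPolynomial.coeff_X_mul, monomialSum]

end MonomialSums

/-! ### Complexification of multilinear maps -/

section Complexification

variable {V₁ V₂ W : Type*} [AddCommGroup V₁] [Module ℝ V₁] [AddCommGroup V₂] [Module ℝ V₂]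
  [AddCommGroup W] [Module ℝ W] [Module ℂ W] [IsScalarTower ℝ ℂ W]

/-- The `ℂ`-bilinear extension of an `ℝ`-bilinear map with values in a complex vector space. -/
def complexify₂ (B : V₁ →ₗ[ℝ] V₂ →ₗ[ℝ] W) : (ℂ ⊗[ℝ] V₁) →ₗ[ℂ] (ℂ ⊗[ℝ] V₂) →ₗ[ℂ] W :=
  LinearMap.liftBaseChange ℂ
    (((LinearMap.liftBaseChangeEquiv ℂ).toLinearMap.restrictScalars ℝ) ∘ₗ B)

@[simp]
theorem complexify₂_tmul (B : V₁ →ₗ[ℝ] V₂ →ₗ[ℝ] W) (z w : ℂ) (a : V₁) (b : V₂) :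
    complexify₂ B (z ⊗ₜ a) (w ⊗ₜ b) = z • w • B a b := by
  simp [complexify₂]

end Complexification

/-! ### Polynomials acting on trilinear forms -/

section TrilinearForms

variable {V F : Type*} [AddCommGroup V] [Module ℝ V] [AddCommGroup F] [Module ℝ F] {N : ℕ}

/-- The ordered monomial `f₁^{I₁} ⋯ f_N^{I_N}`. -/
def orderedMonomial {A : Type*} [Monoid A] (f : Fin N → A) (I : Fin N → ℕ) : A :=
  (List.ofFn fun i => f i ^ I i).prod

theorem orderedMonomial_apply_eigenvector {K U : Type*} [CommRing K] [AddCommGroup U] [Module K U]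
    {f : Fin N → Module.End K U} {χ : Fin N → K} {u : U} (hu : ∀ i, f i u = χ i • u)
    (I : Fin N → ℕ) : orderedMonomial f I u = (∏ i, χ i ^ I i) • u := by
  unfold orderedMonomial
  induction N with
  | zero => simp
  | succ N ih =>
    have hpow : ∀ n : ℕ, (f 0 ^ n) u = χ 0 ^ n • u := fun n => by
      induction n with
      | zero => simp
      | succ n ihn => rw [pow_succ, Module.End.mul_apply, hu, map_smul, ihn, smul_smul, pow_succ']
    rw [List.ofFn_succ, List.prod_cons, Module.End.mul_apply,
      ih (f := fun i => f i.succ) (χ := fun i => χ i.succ) (fun i => hu i.succ), map_smul, hpow,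
      smul_smul, Fin.prod_univ_succ, mul_comm]

theorem baseChange_orderedMonomial (f : Fin N → Module.End ℝ V) (I : Fin N → ℕ) :
    (orderedMonomial f I).baseChange ℂ = orderedMonomial (fun i => (f i).baseChange ℂ) I := by
  have h : ∀ g : Module.End ℝ V, g.baseChange ℂ = Module.End.baseChangeHom ℝ ℂ V g := fun _ => rfl
  simp only [h, orderedMonomial, map_list_prod, List.map_ofFn, Function.comp_def, map_pow]

/-- The trilinear form `(a, b, c) ↦ h(B(a, b), c)`, extended complex trilinearly. -/
def complexTrilinear (B : V →ₗ[ℝ] V →ₗ[ℝ] F) (h : F →ₗ[ℝ] V →ₗ[ℝ] ℝ)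
    (a b c : ℂ ⊗[ℝ] V) : ℂ :=
  complexify₂ (h.compr₂ (Algebra.linearMap ℝ ℂ))
    (complexify₂ (B.compr₂ (TensorProduct.mk ℝ ℂ F 1)) a b) c

/-- The point `(l, m, n)` at which a polynomial in the variables `xᵢ`, `yᵢ`, `zᵢ` is evaluated. -/
def triplePoint {K : Type*} (l m n : Fin N → K) (v : Fin 3 × Fin N) : K := ![l, m, n] v.1 v.2

variable (B : V →ₗ[ℝ] V →ₗ[ℝ] F) (h : F →ₗ[ℝ] V →ₗ[ℝ] ℝ) (f : Fin N → Module.End ℝ V)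

/-- The action of a polynomial on the complex trilinear extension of `h(B(a, b), c)`. -/
def complexPolyAct (P : MvPolynomial (Fin 3 × Fin N) ℝ) (a b c : ℂ ⊗[ℝ] V) : ℂ :=
  ∑ d ∈ P.support, ((P.coeff d : ℝ) : ℂ) * complexTrilinear B h
    ((orderedMonomial f fun i => d (0, i)).baseChange ℂ a)
    ((orderedMonomial f fun i => d (1, i)).baseChange ℂ b)
    ((orderedMonomial f fun i => d (2, i)).baseChange ℂ c)

variable {B h f}

theorem complexPolyAct_add_left (P : MvPolynomial (Fin 3 × Fin N) ℝ) (a a' b c : ℂ ⊗[ℝ] V) :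
    complexPolyAct B h f P (a + a') b c =
      complexPolyAct B h f P a b c + complexPolyAct B h f P a' b c := by
  simp only [complexPolyAct, complexTrilinear, map_add, LinearMap.add_apply, mul_add,
    Finset.sum_add_distrib]

theorem complexPolyAct_add_mid (P : MvPolynomial (Fin 3 × Fin N) ℝ) (a b b' c : ℂ ⊗[ℝ] V) :
    complexPolyAct B h f P a (b + b') c =
      complexPolyAct B h f P a b c + complexPolyAct B h f P a b' c := by
  simp only [complexPolyAct, complexTrilinear, map_add, LinearMap.add_apply, mul_add,
    Finset.sum_add_distrib]

theorem complexPolyAct_add_right (P : MvPolynomial (Fin 3 × Fin N) ℝ) (a b c c' : ℂ ⊗[ℝ] V) :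
    complexPolyAct B h f P a b (c + c') =
      complexPolyAct B h f P a b c + complexPolyAct B h f P a b c' := by
  simp only [complexPolyAct, complexTrilinear, map_add, mul_add, Finset.sum_add_distrib]

theorem complexPolyAct_tmul (P : MvPolynomial (Fin 3 × Fin N) ℝ) (z w t : ℂ) (a b c : V) :
    complexPolyAct B h f P (z ⊗ₜ a) (w ⊗ₜ b) (t ⊗ₜ c) = z * w * t * (monomialSum (fun d =>
      h (B (orderedMonomial f (fun i => d (0, i)) a) (orderedMonomial f (fun i => d (1, i)) b))
        (orderedMonomial f (fun i => d (2, i)) c)) P : ℝ) := by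
  simp only [complexPolyAct, monomialSum, complexTrilinear, LinearMap.baseChange_tmul,
    complexify₂_tmul, LinearMap.compr₂_apply, TensorProduct.mk_apply, map_smul,
    LinearMap.smul_apply, Algebra.linearMap_apply, Complex.coe_algebraMap, smul_eq_mul,
    Complex.ofReal_sum, Complex.ofReal_mul, Finset.mul_sum, one_mul]
  exact Finset.sum_congr rfl fun d _ => by ring

/-- A polynomial that annihilates a real trilinear form annihilates its complex extension. -/
theorem complexPolyAct_eq_zero {P : MvPolynomial (Fin 3 × Fin N) ℝ}
    (hP : ∀ a b c, monomialSum (fun d =>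
      h (B (orderedMonomial f (fun i => d (0, i)) a) (orderedMonomial f (fun i => d (1, i)) b))
        (orderedMonomial f (fun i => d (2, i)) c)) P = 0) (a b c : ℂ ⊗[ℝ] V) :
    complexPolyAct B h f P a b c = 0 := by
  induction a with
  | zero => simp [complexPolyAct, complexTrilinear]
  | add a a' ha ha' => rw [complexPolyAct_add_left, ha, ha', add_zero]
  | tmul z a =>
    induction b with
    | zero => simp [complexPolyAct, complexTrilinear]
    | add b b' hb hb' => rw [complexPolyAct_add_mid, hb, hb', add_zero]
    | tmul w b =>
      induction c with
      | zero => simp [complexPolyAct, complexTrilinear]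
      | add c c' hc hc' => rw [complexPolyAct_add_right, hc, hc', add_zero]
      | tmul t c => rw [complexPolyAct_tmul, hP, Complex.ofReal_zero, mul_zero]

theorem complexPolyAct_eigenvectors (P : MvPolynomial (Fin 3 × Fin N) ℝ) {l m n : Fin N → ℂ}
    {a b c : ℂ ⊗[ℝ] V} (ha : ∀ i, (f i).baseChange ℂ a = l i • a)
    (hb : ∀ i, (f i).baseChange ℂ b = m i • b) (hc : ∀ i, (f i).baseChange ℂ c = n i • c) :
    complexPolyAct B h f P a b c =
      MvPolynomial.aeval (triplePoint l m n) P * complexTrilinear B h a b c := by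
  rw [MvPolynomial.aeval_def, MvPolynomial.eval₂_eq', Finset.sum_mul, complexPolyAct]
  refine Finset.sum_congr rfl fun d _ => ?_
  simp only [baseChange_orderedMonomial]
  rw [orderedMonomial_apply_eigenvector ha, orderedMonomial_apply_eigenvector hb,
    orderedMonomial_apply_eigenvector hc, Fintype.prod_prod_type, Fin.prod_univ_three]
  simp only [complexTrilinear, map_smul, LinearMap.smul_apply, smul_eq_mul, triplePoint,
    Matrix.cons_val, Complex.coe_algebraMap]
  ring

/-- If the complexification is spanned by joint eigenvectors, it suffices to test the vanishing of
`P • T` on joint eigenvectors, where `P` acts by its value at the triple of eigenvalues. -/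
theorem monomialSum_eq_zero_of_eigenvectors
    (hspan : ⨆ χ : Fin N → ℂ, ⨅ i, Module.End.eigenspace ((f i).baseChange ℂ) (χ i) = ⊤)
    {P : MvPolynomial (Fin 3 × Fin N) ℝ}
    (hP : ∀ (l m n : Fin N → ℂ) (a b c : ℂ ⊗[ℝ] V), (∀ i, (f i).baseChange ℂ a = l i • a) →
      (∀ i, (f i).baseChange ℂ b = m i • b) → (∀ i, (f i).baseChange ℂ c = n i • c) →
      MvPolynomial.aeval (triplePoint l m n) P * complexTrilinear B h a b c = 0) (a b c : V) :
    monomialSum (fun d =>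
      h (B (orderedMonomial f (fun i => d (0, i)) a) (orderedMonomial f (fun i => d (1, i)) b))
        (orderedMonomial f (fun i => d (2, i)) c)) P = 0 := by
  have key : ∀ a b c : ℂ ⊗[ℝ] V, complexPolyAct B h f P a b c = 0 := by
    intro a b c
    have mem : ∀ v : ℂ ⊗[ℝ] V,
        v ∈ ⨆ χ : Fin N → ℂ, ⨅ i, Module.End.eigenspace ((f i).baseChange ℂ) (χ i) := fun v => by
      rw [hspan]; trivial
    refine Submodule.iSup_induction _ (motive := fun a => complexPolyAct B h f P a b c = 0)
      (mem a) (fun l a ha => ?_) ?_ fun a a' ha ha' => ?_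
    · refine Submodule.iSup_induction _ (motive := fun b => complexPolyAct B h f P a b c = 0)
        (mem b) (fun m b hb => ?_) ?_ fun b b' hb hb' => ?_
      · refine Submodule.iSup_induction _ (motive := fun c => complexPolyAct B h f P a b c = 0)
          (mem c) (fun n c hc => ?_) ?_ fun c c' hc hc' => ?_
        · simp only [Submodule.mem_iInf, Module.End.mem_eigenspace_iff] at ha hb hc
          rw [complexPolyAct_eigenvectors P ha hb hc]
          exact hP l m n a b c ha hb hc
        · simp [complexPolyAct, complexTrilinear]
        · rw [complexPolyAct_add_right, hc, hc', add_zero]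
      · simp [complexPolyAct, complexTrilinear]
      · rw [complexPolyAct_add_mid, hb, hb', add_zero]
    · simp [complexPolyAct, complexTrilinear]
    · rw [complexPolyAct_add_left, ha, ha', add_zero]
  have := key (1 ⊗ₜ a) (1 ⊗ₜ b) (1 ⊗ₜ c)
  rw [complexPolyAct_tmul] at this
  simpa using this

end TrilinearForms

/-! ### The Leibniz rules of the Courant-Dorfman bracket -/

section VectorSpace

variable {E : Type*} [NormedAddCommGroup E] [NormedSpace ℝ E]
  {X Y : E → E} {α β : E → (E →L[ℝ] ℝ)} {g : E → ℝ} {y : E}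

theorem lieDerivForm_smul_right (hg : DifferentiableAt ℝ g y) (hβ : DifferentiableAt ℝ β y) :
    lieDerivForm X (fun z => g z • β z) y =
      g y • lieDerivForm X β y + fderiv ℝ g y (X y) • β y := by
  ext v
  simp only [lieDerivForm, fderiv_fun_smul hg hβ]
  simp
  ring

theorem lieDerivForm_smul_left (hg : DifferentiableAt ℝ g y) (hX : DifferentiableAt ℝ X y) :
    lieDerivForm (fun z => g z • X z) β y =
      g y • lieDerivForm X β y + β y (X y) • fderiv ℝ g y := by
  ext v
  simp only [lieDerivForm, fderiv_fun_smul hg hX]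
  simp
  ring

theorem contrExtDeriv_smul_left : contrExtDeriv (fun z => g z • Y z) α y =
    g y • contrExtDeriv Y α y := by
  simp [contrExtDeriv, smul_sub]

theorem contrExtDeriv_smul_right (hg : DifferentiableAt ℝ g y) (hα : DifferentiableAt ℝ α y) :
    contrExtDeriv Y (fun z => g z • α z) y =
      g y • contrExtDeriv Y α y + fderiv ℝ g y (Y y) • α y - α y (Y y) • fderiv ℝ g y := by
  ext v
  simp only [contrExtDeriv, fderiv_fun_smul hg hα]
  simp
  ring

theorem lieDerivForm_add_left {X' : E → E} (hX : DifferentiableAt ℝ X y)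
    (hX' : DifferentiableAt ℝ X' y) :
    lieDerivForm (fun z => X z + X' z) β y = lieDerivForm X β y + lieDerivForm X' β y := by
  ext v
  simp only [lieDerivForm, fderiv_fun_add hX hX']
  simp
  ring

theorem lieDerivForm_add_right {β' : E → (E →L[ℝ] ℝ)} (hβ : DifferentiableAt ℝ β y)
    (hβ' : DifferentiableAt ℝ β' y) :
    lieDerivForm X (fun z => β z + β' z) y = lieDerivForm X β y + lieDerivForm X β' y := by
  ext v
  simp only [lieDerivForm, fderiv_fun_add hβ hβ']
  simp
  ring

theorem contrExtDeriv_add_left {Y' : E → E} :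
    contrExtDeriv (fun z => Y z + Y' z) α y = contrExtDeriv Y α y + contrExtDeriv Y' α y := by
  ext v
  simp [contrExtDeriv]
  ring

theorem contrExtDeriv_add_right {α' : E → (E →L[ℝ] ℝ)} (hα : DifferentiableAt ℝ α y)
    (hα' : DifferentiableAt ℝ α' y) :
    contrExtDeriv Y (fun z => α z + α' z) y = contrExtDeriv Y α y + contrExtDeriv Y α' y := by
  ext v
  simp only [contrExtDeriv, fderiv_fun_add hα hα']
  simp
  ring

end VectorSpace

section Leibniz

variable {E : Type u} [NormedAddCommGroup E] [NormedSpace ℝ E]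
  {M : Type u} [TopologicalSpace M] [ChartedSpace E M]

theorem GTan.ext {x : M} {u v : GTan E M x} (h₁ : u.vec = v.vec) (h₂ : u.form = v.form) : u = v :=
  Prod.ext h₁ h₂

theorem vecInChart_add (x : M) (X X' : ∀ p : M, TangentSpace 𝓘(ℝ, E) p) :
    vecInChart x (fun p => X p + X' p) = fun y => vecInChart x X y + vecInChart x X' y :=
  VectorField.mpullback_add

theorem vecInChart_smul (x : M) (f : M → ℝ) (X : ∀ p : M, TangentSpace 𝓘(ℝ, E) p) :
    vecInChart x (fun p => f p • X p) =
      fun y => f ((extChartAt 𝓘(ℝ, E) x).symm y) • vecInChart x X y :=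
  VectorField.mpullback_smul

theorem formInChart_add (x : M) (α α' : ∀ p : M, Cotangent E M p) :
    formInChart x (fun p => α p + α' p) = fun y => formInChart x α y + formInChart x α' y :=
  rfl

theorem formInChart_smul (x : M) (f : M → ℝ) (α : ∀ p : M, Cotangent E M p) :
    formInChart x (fun p => f p • α p) =
      fun y => f ((extChartAt 𝓘(ℝ, E) x).symm y) • formInChart x α y :=
  rfl

theorem mdifferentiableAt_coe (f : C^∞⟮𝓘(ℝ, E), M; ℝ⟯) (x : M) :
    MDifferentiableAt 𝓘(ℝ, E) 𝓘(ℝ, ℝ) f x :=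
  f.contMDiff.contMDiffAt.mdifferentiableAt (by simp)

/-- The differential of a smooth function at a point. -/
def differential (f : C^∞⟮𝓘(ℝ, E), M; ℝ⟯) (x : M) : Cotangent E M x :=
  mvfderiv 𝓘(ℝ, E) f x

theorem differentiableAt_comp_extChartAt_symm (f : C^∞⟮𝓘(ℝ, E), M; ℝ⟯) (x : M) :
    DifferentiableAt ℝ (fun y => f ((extChartAt 𝓘(ℝ, E) x).symm y)) (extChartAt 𝓘(ℝ, E) x x) := by
  have h := (mdifferentiableAt_coe f x).differentiableWithinAt_writtenInExtChartAt
  rw [ModelWithCorners.range_eq_univ, differentiableWithinAt_univ] at h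
  exact h

theorem fderiv_comp_extChartAt_symm (f : C^∞⟮𝓘(ℝ, E), M; ℝ⟯) (x : M) :
    fderiv ℝ (fun y => f ((extChartAt 𝓘(ℝ, E) x).symm y)) (extChartAt 𝓘(ℝ, E) x x) =
      differential f x := by
  have h := (mdifferentiableAt_coe f x).mfderiv
  rw [ModelWithCorners.range_eq_univ, fderivWithin_univ] at h
  exact h.symm

variable [IsManifold 𝓘(ℝ, E) ∞ M]

theorem mdifferentiableAt_vec (a : GSec E M) (x : M) :
    MDifferentiableAt 𝓘(ℝ, E) 𝓘(ℝ, E).tangent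
      (fun p => (⟨p, (a p).vec⟩ : TangentBundle 𝓘(ℝ, E) M)) x := by
  refine ContMDiffAt.mdifferentiableAt (n := ∞) ?_ (by simp)
  have h := (Bundle.contMDiffAt_section x).1 (a.contMDiff x)
  rw [Bundle.contMDiffAt_section]
  exact (contDiff_fst (𝕜 := ℝ) (E := E) (F := E →L[ℝ] ℝ) (n := ∞)).contMDiff.contMDiffAt.comp x h

theorem contMDiffAt_form (a : GSec E M) (x : M) :
    ContMDiffAt 𝓘(ℝ, E) (𝓘(ℝ, E).prod 𝓘(ℝ, E →L[ℝ] ℝ)) ∞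
      (fun p => (⟨p, (a p).form⟩ : Bundle.TotalSpace (E →L[ℝ] ℝ) (Cotangent E M))) x := by
  have h := (Bundle.contMDiffAt_section x).1 (a.contMDiff x)
  rw [Bundle.contMDiffAt_section]
  exact (contDiff_snd (𝕜 := ℝ) (E := E) (F := E →L[ℝ] ℝ) (n := ∞)).contMDiff.contMDiffAt.comp x h

theorem differentiableAt_vecInChart [CompleteSpace E] (a : GSec E M) (x : M) :
    DifferentiableAt ℝ (vecInChart x fun p => (a p).vec) (extChartAt 𝓘(ℝ, E) x x) := by
  have : IsManifold 𝓘(ℝ, E) 2 M := IsManifold.of_le (n := ∞) (by norm_cast)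
  have h := MDifferentiableWithinAt.differentiableWithinAt_mpullbackWithin_vectorField
    (mdifferentiableAt_vec a x).mdifferentiableWithinAt (s := Set.univ)
  rw [ModelWithCorners.range_eq_univ, VectorField.mpullbackWithin_univ, Set.preimage_univ,
    Set.inter_univ] at h
  exact differentiableWithinAt_univ.1 h

theorem differentiableAt_formInChart (a : GSec E M) (x : M) :
    DifferentiableAt ℝ (formInChart x fun p => (a p).form) (extChartAt 𝓘(ℝ, E) x x) := by
  have : IsManifold 𝓘(ℝ, E) 1 M := IsManifold.of_le (n := ∞) (by norm_cast)
  have h := (Bundle.contMDiffAt_section x).1 (contMDiffAt_form a x)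
  have h1 : ContMDiffAt 𝓘(ℝ, E) 𝓘(ℝ, E) ∞ (extChartAt 𝓘(ℝ, E) x).symm
      (extChartAt 𝓘(ℝ, E) x x) :=
    (contMDiffOn_extChartAt_symm x).contMDiffAt (extChartAt_target_mem_nhds x)
  rw [← extChartAt_to_inv (I := 𝓘(ℝ, E)) x] at h
  have h2 := (h.comp _ h1).contDiffAt.differentiableAt (by simp)
  refine h2.congr_of_eventuallyEq ?_
  filter_upwards [extChartAt_target_mem_nhds (I := 𝓘(ℝ, E)) x] with y hy
  have hs : (extChartAt 𝓘(ℝ, E) x).symm y ∈ (chartAt E x).source := by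
    rw [← extChartAt_source 𝓘(ℝ, E)]
    exact (extChartAt 𝓘(ℝ, E) x).map_target hy
  have key := TangentBundle.symmL_trivializationAt (I := 𝓘(ℝ, E)) hs
  rw [ModelWithCorners.range_eq_univ, mfderivWithin_univ, PartialEquiv.right_inv _ hy] at key
  simp only [Function.comp_apply, hom_trivializationAt_apply, ContinuousLinearMap.inCoordinates]
  rw [extChartAt_to_inv, key]
  ext v
  simp only [Bundle.Trivial.fiberBundle_trivializationAt',
    Bundle.Trivial.continuousLinearMapAt_trivialization]
  rfl

theorem vecInChart_self (x : M) (X : ∀ p : M, TangentSpace 𝓘(ℝ, E) p) :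
    vecInChart x X (extChartAt 𝓘(ℝ, E) x x) = X x := by
  have : IsManifold 𝓘(ℝ, E) 1 M := IsManifold.of_le (n := ∞) (by norm_cast)
  have h := mfderivWithin_range_extChartAt_symm (I := 𝓘(ℝ, E)) (x := x)
  rw [ModelWithCorners.range_eq_univ, mfderivWithin_univ] at h
  have hX : ∀ p, p = x → (X p : E) = X x := by rintro p rfl; rfl
  rw [vecInChart, VectorField.mpullback_apply, h]
  exact (congrArg (fun L : E →L[ℝ] E => L (X _ : E)) (ContinuousLinearMap.inverse_id ..)).trans
    (hX _ (extChartAt_to_inv (I := 𝓘(ℝ, E)) x))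

theorem formInChart_self (x : M) (α : ∀ p : M, Cotangent E M p) :
    formInChart x α (extChartAt 𝓘(ℝ, E) x x) = α x := by
  have : IsManifold 𝓘(ℝ, E) 1 M := IsManifold.of_le (n := ∞) (by norm_cast)
  have h := mfderivWithin_range_extChartAt_symm (I := 𝓘(ℝ, E)) (x := x)
  rw [ModelWithCorners.range_eq_univ, mfderivWithin_univ] at h
  have hα : ∀ p, p = x → (α p : E →L[ℝ] ℝ) = α x := by rintro p rfl; rfl
  rw [formInChart, h]
  refine Eq.trans ?_ (hα _ (extChartAt_to_inv (I := 𝓘(ℝ, E)) x))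
  rfl

/-- The derivative of the preferred chart at its own base point is the identity, so that no
transport back to the cotangent space remains in the bracket. -/
theorem formBracket_eq (X Y : ∀ p : M, TangentSpace 𝓘(ℝ, E) p) (α β : ∀ p : M, Cotangent E M p)
    (x : M) : (formBracket X Y α β x : E →L[ℝ] ℝ) =
      lieDerivForm (vecInChart x X) (formInChart x β) (extChartAt 𝓘(ℝ, E) x x)
        - contrExtDeriv (vecInChart x Y) (formInChart x α) (extChartAt 𝓘(ℝ, E) x x) := by
  have : IsManifold 𝓘(ℝ, E) 1 M := IsManifold.of_le (n := ∞) (by norm_cast)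
  have h := mfderiv_extChartAt_self (I := 𝓘(ℝ, E)) (x := x)
  rw [formBracket, h]
  rfl

variable [CompleteSpace E]

theorem bracket_add_left (a a' b : GSec E M) (x : M) :
    bracket (a + a') b x = bracket a b x + bracket a' b x := by
  have : IsManifold 𝓘(ℝ, E) 2 M := IsManifold.of_le (n := ∞) (by norm_cast)
  refine GTan.ext ?_ ?_
  · exact VectorField.mlieBracket_add_left (mdifferentiableAt_vec a x) (mdifferentiableAt_vec a' x)
  · change (formBracket (fun p => (a p).vec + (a' p).vec) (fun p => (b p).vec)
      (fun p => (a p).form + (a' p).form) (fun p => (b p).form) x : E →L[ℝ] ℝ) =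
      formBracket _ _ _ _ x + formBracket _ _ _ _ x
    simp only [formBracket_eq]
    rw [vecInChart_add, formInChart_add, lieDerivForm_add_left (differentiableAt_vecInChart a x)
      (differentiableAt_vecInChart a' x), contrExtDeriv_add_right (differentiableAt_formInChart a x)
      (differentiableAt_formInChart a' x)]
    abel

theorem bracket_add_right (a b b' : GSec E M) (x : M) :
    bracket a (b + b') x = bracket a b x + bracket a b' x := by
  have : IsManifold 𝓘(ℝ, E) 2 M := IsManifold.of_le (n := ∞) (by norm_cast)
  refine GTan.ext ?_ ?_
  · exact VectorField.mlieBracket_add_right (mdifferentiableAt_vec b x) (mdifferentiableAt_vec b' x)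
  · change (formBracket (fun p => (a p).vec) (fun p => (b p).vec + (b' p).vec)
      (fun p => (a p).form) (fun p => (b p).form + (b' p).form) x : E →L[ℝ] ℝ) =
      formBracket _ _ _ _ x + formBracket _ _ _ _ x
    simp only [formBracket_eq]
    rw [vecInChart_add, formInChart_add, lieDerivForm_add_right (differentiableAt_formInChart b x)
      (differentiableAt_formInChart b' x), contrExtDeriv_add_left]
    abel

/-- `⟦a, f b⟧ = f ⟦a, b⟧ + (π(a) f) b`. -/
theorem bracket_fsmul_right (f : C^∞⟮𝓘(ℝ, E), M; ℝ⟯) (a b : GSec E M) (x : M) :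
    bracket a (fsmul f b) x = f x • bracket a b x + (differential f x (a x).vec : ℝ) • b x := by
  have : IsManifold 𝓘(ℝ, E) 2 M := IsManifold.of_le (n := ∞) (by norm_cast)
  refine GTan.ext ?_ ?_
  · exact (VectorField.mlieBracket_smul_right (mdifferentiableAt_coe f x)
      (mdifferentiableAt_vec b x)).trans (add_comm _ _)
  · change (formBracket (fun p => (a p).vec) (fun p => f p • (b p).vec)
      (fun p => (a p).form) (fun p => f p • (b p).form) x : E →L[ℝ] ℝ) =
      f x • (formBracket _ _ _ _ x : E →L[ℝ] ℝ)
        + (differential f x (a x).vec : ℝ) • ((b x).form : E →L[ℝ] ℝ)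
    simp only [formBracket_eq]
    rw [vecInChart_smul, formInChart_smul, lieDerivForm_smul_right
      (differentiableAt_comp_extChartAt_symm f x) (differentiableAt_formInChart b x),
      contrExtDeriv_smul_left, fderiv_comp_extChartAt_symm, vecInChart_self, formInChart_self,
      extChartAt_to_inv]
    have aux : ∀ (t s : ℝ) (L C B : E →L[ℝ] ℝ), t • L + s • B - t • C = t • (L - C) + s • B :=
      fun t s L C B => by module
    exact aux ..

/-- `⟦f a, b⟧ = f ⟦a, b⟧ - (π(b) f) a + 2 ⟨a, b⟩ df`. -/
theorem bracket_fsmul_left (f : C^∞⟮𝓘(ℝ, E), M; ℝ⟯) (a b : GSec E M) (x : M) :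
    bracket (fsmul f a) b x = f x • bracket a b x - (differential f x (b x).vec : ℝ) • a x
      + (2 * pairing (a x) (b x)) • GTan.mk 0 (differential f x) := by
  have : IsManifold 𝓘(ℝ, E) 2 M := IsManifold.of_le (n := ∞) (by norm_cast)
  refine GTan.ext ?_ ?_
  · refine (VectorField.mlieBracket_smul_left (mdifferentiableAt_coe f x)
      (mdifferentiableAt_vec a x)).trans ?_
    change _ = f x • VectorField.mlieBracket 𝓘(ℝ, E) (fun p => (a p).vec) (fun p => (b p).vec) x
      - (differential f x (b x).vec : ℝ) • (a x).vec + (2 * pairing (a x) (b x)) • 0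
    rw [smul_zero, add_zero, neg_smul, neg_add_eq_sub]
    rfl
  · change (formBracket (fun p => f p • (a p).vec) (fun p => (b p).vec)
      (fun p => f p • (a p).form) (fun p => (b p).form) x : E →L[ℝ] ℝ) =
      f x • (formBracket _ _ _ _ x : E →L[ℝ] ℝ)
        - (differential f x (b x).vec : ℝ) • ((a x).form : E →L[ℝ] ℝ)
        + (2 * pairing (a x) (b x)) • (differential f x : E →L[ℝ] ℝ)
    simp only [formBracket_eq]
    rw [vecInChart_smul, formInChart_smul, lieDerivForm_smul_left
      (differentiableAt_comp_extChartAt_symm f x) (differentiableAt_vecInChart a x),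
      contrExtDeriv_smul_right (differentiableAt_comp_extChartAt_symm f x)
      (differentiableAt_formInChart a x), fderiv_comp_extChartAt_symm, vecInChart_self,
      formInChart_self, vecInChart_self, formInChart_self, extChartAt_to_inv, pairing,
      mul_div_cancel₀ _ two_ne_zero]
    have aux : ∀ (t s r q : ℝ) (L C A D : E →L[ℝ] ℝ),
        t • L + r • D - (t • C + s • A - q • D) = t • (L - C) - s • A + (q + r) • D :=
      fun t s r q L C A D => by module
    exact aux ..

end Leibniz

/-! ### The pairing, the bracket and the evaluation as multilinear maps -/

section Multilinear

variable {E : Type u} [NormedAddCommGroup E] [NormedSpace ℝ E]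
  {M : Type u} [TopologicalSpace M] [ChartedSpace E M]

/-- The tautological inner product as a bilinear map. -/
def pairingₗ (x : M) : GTan E M x →ₗ[ℝ] GTan E M x →ₗ[ℝ] ℝ :=
  have hv : ∀ (r : ℝ) (u : GTan E M x), (r • u).vec = r • u.vec := fun _ _ => rfl
  have hf : ∀ (r : ℝ) (u v : GTan E M x), ((r • u).form v.vec : ℝ) = r * u.form v.vec :=
    fun _ _ _ => rfl
  have hv' : ∀ (u v : GTan E M x), (u + v).vec = u.vec + v.vec := fun _ _ => rfl
  have hf' : ∀ (u v w : GTan E M x),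
    ((u + v).form w.vec : ℝ) = u.form w.vec + v.form w.vec := fun _ _ _ => rfl
  LinearMap.mk₂ ℝ pairing
    (fun u v w => by
      simp only [pairing, hv', hf', map_add]
      change (_ + ((w.form u.vec : ℝ) + (w.form v.vec : ℝ))) / 2 = _
      ring)
    (fun r u v => by
      simp only [pairing, hv, hf, map_smul]
      change (_ + r * (v.form u.vec : ℝ)) / 2 = r * _
      ring)
    (fun u v w => by
      simp only [pairing, hv', hf', map_add]
      change (((u.form v.vec : ℝ) + (u.form w.vec : ℝ)) + _) / 2 = _
      ring)
    (fun r u v => by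
      simp only [pairing, hv, hf, map_smul]
      change (r * (u.form v.vec : ℝ) + _) / 2 = r * _
      ring)

@[simp]
theorem pairingₗ_apply {x : M} (u v : GTan E M x) : pairingₗ x u v = pairing u v := rfl

theorem eq_zero_of_pairing_eq_zero {x : M} {u : GTan E M x} (h : ∀ v, pairing u v = 0) :
    u = 0 := by
  refine GTan.ext ?_ ?_
  · refine SeparatingDual.eq_zero_of_forall_dual_eq_zero (R := ℝ) (V := E) fun β => ?_
    have := h (GTan.mk 0 β)
    simp only [pairing] at this
    change (((u.form (0 : TangentSpace 𝓘(ℝ, E) x) : ℝ)) + (β u.vec : ℝ)) / 2 = 0 at this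
    rw [map_zero] at this
    change ((0 : ℝ) + (β u.vec : ℝ)) / 2 = 0 at this
    linarith
  · refine ContinuousLinearMap.ext fun Y => ?_
    have := h (GTan.mk Y 0)
    change ((u.form Y : ℝ) + (0 : ℝ)) / 2 = 0 at this
    change (u.form Y : ℝ) = 0
    linarith

variable [IsManifold 𝓘(ℝ, E) ∞ M]

/-- The evaluation of smooth sections at a point. -/
def evalₗ (x : M) : GSec E M →ₗ[ℝ] GTan E M x where
  toFun a := a x
  map_add' _ _ := rfl
  map_smul' _ _ := rfl

/-- A vector is extended to a section that is constant in a local trivialization, and this section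
is cut off by a bump function. -/
theorem evalₗ_surjective [FiniteDimensional ℝ E] [T2Space M] (x : M) :
    Function.Surjective (evalₗ (E := E) x) := by
  intro u
  obtain ⟨s, hs, hsu⟩ := FiberBundle.exists_contMDiffOn_extend (k := ∞) 𝓘(ℝ, E) (GFib E) u
  obtain ⟨f, -, hf⟩ := (SmoothBumpFunction.nhds_basis_tsupport (I := 𝓘(ℝ, E)) x).mem_iff.1
    (interior_mem_nhds.2 hs)
  refine ⟨⟨fun p => f p • FiberBundle.extend (GFib E) u p, ?_⟩, ?_⟩
  · exact ContMDiffOn.smul_section_of_tsupport f.contMDiff.contMDiffOn isOpen_interior hf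
      (hsu.mono interior_subset)
  · change f x • FiberBundle.extend (GFib E) u x = u
    rw [f.eq_one, one_smul, FiberBundle.extend_apply_self]

variable [CompleteSpace E]

/-- The Courant-Dorfman bracket at a point as a bilinear map. -/
def bracketₗ (x : M) : GSec E M →ₗ[ℝ] GSec E M →ₗ[ℝ] GTan E M x :=
  have hd : ∀ r : ℝ, differential (ContMDiffMap.const r : C^∞⟮𝓘(ℝ, E), M; ℝ⟯) x = 0 := fun r => by
    change mvfderiv 𝓘(ℝ, E) (fun _ => r) x = 0
    ext v
    simp [mvfderiv]
  LinearMap.mk₂ ℝ (fun a b => bracket a b x)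
    (fun a a' b => bracket_add_left a a' b x)
    (fun r a b => by
      change bracket (fsmul (ContMDiffMap.const r) a) b x = _
      rw [bracket_fsmul_left, hd]
      change r • _ - (0 : ℝ) • _ + _ • (0 : GTan E M x) = _
      rw [zero_smul, smul_zero, sub_zero, add_zero])
    (fun a b b' => bracket_add_right a b b' x)
    (fun r a b => by
      change bracket a (fsmul (ContMDiffMap.const r) b) x = _
      rw [bracket_fsmul_right, hd]
      change r • _ + (0 : ℝ) • _ = _
      rw [zero_smul, add_zero])

@[simp]
theorem bracketₗ_apply (x : M) (a b : GSec E M) : bracketₗ x a b = bracket a b x := rfl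

end Multilinear

/-! ### Tensoriality defects of the polynomial action -/

section OrderedMonomials

theorem commute_orderedMonomial {A : Type*} [Monoid A] {N : ℕ} {f : Fin N → A} {g : A}
    (hg : ∀ i, Commute g (f i)) (I : Fin N → ℕ) : Commute g (orderedMonomial f I) := by
  refine Commute.list_prod_right _ _ fun y hy => ?_
  obtain ⟨j, rfl⟩ := (List.mem_ofFn' _ _).1 hy
  exact (hg _).pow_right _

theorem orderedMonomial_single_add {A : Type*} [Monoid A] {N : ℕ} {f : Fin N → A}
    (hf : ∀ i j, Commute (f i) (f j)) (i : Fin N) (I : Fin N → ℕ) :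
    orderedMonomial f (Pi.single i 1 + I) = orderedMonomial f I * f i := by
  unfold orderedMonomial
  induction N with
  | zero => exact i.elim0
  | succ N ih =>
    rw [List.ofFn_succ, List.ofFn_succ, List.prod_cons, List.prod_cons]
    refine Fin.cases ?_ (fun i => ?_) i
    · have hc : Commute (f 0) (List.ofFn fun j : Fin N => f j.succ ^ I j.succ).prod :=
        commute_orderedMonomial (fun i : Fin N => hf 0 i.succ) fun j => I j.succ
      have h1 : ∀ j : Fin N, (Pi.single (0 : Fin (N + 1)) 1 + I : Fin (N + 1) → ℕ) j.succ =
          I j.succ := fun j => by simp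
      simp only [h1]
      rw [Pi.add_apply, Pi.single_eq_same, pow_add, pow_one, mul_assoc]
      exact (((Commute.refl _).pow_right _).mul_right hc).eq
    · have h1 : ∀ j : Fin N, (Pi.single i.succ 1 + I : Fin (N + 1) → ℕ) j.succ =
          (Pi.single i 1 + fun j => I j.succ : Fin N → ℕ) j := fun j => by
        simp [Pi.single_apply]
      simp only [h1]
      rw [ih (f := fun j => f j.succ) (fun i j => hf _ _) i (fun j => I j.succ), Pi.add_apply,
        Pi.single_eq_of_ne (Fin.succ_ne_zero i).symm, zero_add, mul_assoc]

end OrderedMonomials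

section PolynomialForms

variable {V : Type*} [AddCommGroup V] [Module ℝ V] {N : ℕ} {f : Fin N → Module.End ℝ V}

/-- The value at `(a, b, c)` of the action of `P` on a function `σ` of three vectors: the sum of
`r_{I,J,K} σ(f^I a, f^J b, f^K c)` over the monomials `r_{I,J,K} x^I y^J z^K` of `P`. -/
def formAct (f : Fin N → Module.End ℝ V) (σ : V → V → V → ℝ) (P : PolyRing N) (a b c : V) : ℝ :=
  monomialSum (fun d => σ (orderedMonomial f (fun i => d (0, i)) a)
    (orderedMonomial f (fun i => d (1, i)) b) (orderedMonomial f (fun i => d (2, i)) c)) P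

/-- If moving `fᵢ` from the argument number `t` to the argument number `s` of `σ` multiplies `σ` by
`e`, then every multiple of the corresponding difference of variables annihilates `σ`. -/
theorem formAct_eq_zero_of_swap (hf : ∀ i j, Commute (f i) (f j)) {σ : V → V → V → ℝ}
    {i : Fin N} {e : ℝ} {s t : Fin 3} (a b c : V)
    (hσ : ∀ v : Fin 3 → V, σ (Function.update v s (f i (v s)) 0)
        (Function.update v s (f i (v s)) 1) (Function.update v s (f i (v s)) 2) =
      e * σ (Function.update v t (f i (v t)) 0)
        (Function.update v t (f i (v t)) 1) (Function.update v t (f i (v t)) 2))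
    (P : PolyRing N) :
    formAct f σ ((MvPolynomial.X (s, i) - MvPolynomial.C e * MvPolynomial.X (t, i)) * P) a b c =
      0 := by
  have key : ∀ (s : Fin 3) (d : Fin 3 × Fin N →₀ ℕ) (r : Fin 3),
      orderedMonomial f (fun j => (Finsupp.single (s, i) 1 + d : Fin 3 × Fin N →₀ ℕ) (r, j))
          (![a, b, c] r) =
        Function.update (fun r => orderedMonomial f (fun j => d (r, j)) (![a, b, c] r)) s
          (f i (orderedMonomial f (fun j => d (s, j)) (![a, b, c] s))) r := by
    intro s d r
    rcases eq_or_ne r s with rfl | hrs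
    · rw [Function.update_self, ← Module.End.mul_apply, (commute_orderedMonomial (hf i) _).eq,
        ← orderedMonomial_single_add hf]
      congr 2
      funext j
      simp [Finsupp.single_apply, Pi.single_apply, eq_comm]
    · rw [Function.update_of_ne hrs]
      congr 2
      funext j
      simp [hrs.symm]
  have hsplit : (MvPolynomial.X (s, i) - MvPolynomial.C e * MvPolynomial.X (t, i)) * P =
      MvPolynomial.X (s, i) * P + MvPolynomial.C (-e) * (MvPolynomial.X (t, i) * P) := by
    rw [map_neg]; ring
  rw [formAct, hsplit, monomialSum_add, monomialSum_C_mul, monomialSum_X_mul, monomialSum_X_mul]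
  simp only [monomialSum, Finset.mul_sum, ← Finset.sum_add_distrib]
  refine Finset.sum_eq_zero fun d _ => ?_
  have h := fun s d => And.intro (key s d 0) (And.intro (key s d 1) (key s d 2))
  simp only [Matrix.cons_val] at h
  rw [(h s d).1, (h s d).2.1, (h s d).2.2, (h t d).1, (h t d).2.1, (h t d).2.2]
  have := hσ (fun r => orderedMonomial f (fun j => d (r, j)) (![a, b, c] r))
  rw [this]
  ring

theorem formAct_eigenvectors {σ : V → V → V → ℝ}
    (hσ : ∀ (r s t : ℝ) (a b c : V), σ (r • a) (s • b) (t • c) = r * s * t * σ a b c)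
    (P : PolyRing N) {l m n : Fin N → ℝ} {a b c : V}
    (ha : ∀ i, f i a = l i • a) (hb : ∀ i, f i b = m i • b) (hc : ∀ i, f i c = n i • c) :
    formAct f σ P a b c =
      MvPolynomial.eval (triplePoint l m n) P * σ a b c := by
  rw [MvPolynomial.eval_eq', Finset.sum_mul, formAct, monomialSum]
  refine Finset.sum_congr rfl fun d _ => ?_
  rw [orderedMonomial_apply_eigenvector ha, orderedMonomial_apply_eigenvector hb,
    orderedMonomial_apply_eigenvector hc, Fintype.prod_prod_type, Fin.prod_univ_three]
  simp only [hσ, triplePoint, Matrix.cons_val]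
  ring

end PolynomialForms

section Defects

variable {E : Type u} [NormedAddCommGroup E] [NormedSpace ℝ E]
  {M : Type u} [TopologicalSpace M] [ChartedSpace E M]

theorem pairing_add_left {x : M} (u v w : GTan E M x) :
    pairing (u + v) w = pairing u w + pairing v w := LinearMap.map_add₂ (pairingₗ x) u v w

theorem pairing_add_right {x : M} (u v w : GTan E M x) :
    pairing u (v + w) = pairing u v + pairing u w := (pairingₗ x u).map_add v w

theorem pairing_smul_left {x : M} (r : ℝ) (u v : GTan E M x) :
    pairing (r • u) v = r * pairing u v := LinearMap.map_smul₂ (pairingₗ x) r u v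

theorem pairing_smul_right {x : M} (r : ℝ) (u v : GTan E M x) :
    pairing u (r • v) = r * pairing u v := (pairingₗ x u).map_smul r v

theorem pairing_sub_left {x : M} (u v w : GTan E M x) :
    pairing (u - v) w = pairing u w - pairing v w := LinearMap.map_sub₂ (pairingₗ x) u v w

theorem pairing_mk_zero {x : M} (α : Cotangent E M x) (u : GTan E M x) :
    pairing (GTan.mk 0 α) u = (α u.vec : ℝ) / 2 := by
  change ((α u.vec : ℝ) + (u.form (0 : TangentSpace 𝓘(ℝ, E) x) : ℝ)) / 2 = _
  rw [map_zero, add_zero]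

variable [IsManifold 𝓘(ℝ, E) ∞ M] {N : ℕ} {ε : Fin N → ℤˣ}

/-- The derivative `(π(a) f)(x)` of a function along the anchor of a section. -/
def anchorDeriv (f : C^∞⟮𝓘(ℝ, E), M; ℝ⟯) (x : M) (a : GSec E M) : ℝ :=
  differential f x (a x).vec

theorem anchorDeriv_smul (f : C^∞⟮𝓘(ℝ, E), M; ℝ⟯) (x : M) (r : ℝ) (a : GSec E M) :
    anchorDeriv f x (r • a) = r * anchorDeriv f x a :=
  (differential f x).map_smul r (a x).vec

/-- The failure of `τ_C` to be linear over the functions in its second argument. -/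
def midDefect (f : C^∞⟮𝓘(ℝ, E), M; ℝ⟯) (x : M) (a b c : GSec E M) : ℝ :=
  anchorDeriv f x a * pairing (b x) (c x)

/-- The failure of `τ_C` to be linear over the functions in its first argument. -/
def leftDefect (f : C^∞⟮𝓘(ℝ, E), M; ℝ⟯) (x : M) (a b c : GSec E M) : ℝ :=
  anchorDeriv f x c * pairing (a x) (b x) - anchorDeriv f x b * pairing (a x) (c x)

namespace CommutingFamily

variable (φ : CommutingFamily E M N ε)

/-- The operators of the family on smooth sections. -/
def ops (i : Fin N) : Module.End ℝ (GSec E M) := act (φ.toFun i)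

theorem commute_ops (i j : Fin N) : Commute (φ.ops i) (φ.ops j) :=
  LinearMap.ext fun a => ContMDiffSection.ext fun x => φ.comm i j x (a x)

theorem polyAct_eq_formAct (P : PolyRing N) (τ : TriForm E M) (a b c : GSec E M) (x : M) :
    φ.polyAct P τ a b c x = formAct φ.ops (fun a b c => τ a b c x) P a b c := rfl

theorem orderedMonomial_fsmul (f : C^∞⟮𝓘(ℝ, E), M; ℝ⟯) (I : Fin N → ℕ) (a : GSec E M) :
    orderedMonomial φ.ops I (fsmul f a) = fsmul f (orderedMonomial φ.ops I a) := by
  let g : Module.End ℝ (GSec E M) :=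
    { toFun := fsmul f
      map_add' := fun a b => ContMDiffSection.ext fun x => smul_add (f x) (a x) (b x)
      map_smul' := fun r a => ContMDiffSection.ext fun x => smul_comm (f x) r (a x) }
  have h : ∀ i, Commute g (φ.ops i) := fun i =>
    LinearMap.ext fun a => ContMDiffSection.ext fun x => ((φ.toFun i x).map_smul (f x) (a x)).symm
  exact (LinearMap.congr_fun (commute_orderedMonomial h I).eq a).symm

theorem polyAct_fsmul_right (f : C^∞⟮𝓘(ℝ, E), M; ℝ⟯) (P : PolyRing N) (a b c : GSec E M) (x : M) :
    φ.polyAct P courantElement a b (fsmul f c) x = f x * φ.polyAct P courantElement a b c x := by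
  simp only [polyAct_eq_formAct, formAct, monomialSum, Finset.mul_sum]
  refine Finset.sum_congr rfl fun d _ => ?_
  rw [orderedMonomial_fsmul]
  change _ * pairing _ (f x • _) = f x * (_ * pairing _ _)
  rw [pairing_smul_right]
  ring

variable [CompleteSpace E]

theorem polyAct_fsmul_mid (f : C^∞⟮𝓘(ℝ, E), M; ℝ⟯) (P : PolyRing N) (a b c : GSec E M) (x : M) :
    φ.polyAct P courantElement a (fsmul f b) c x =
      f x * φ.polyAct P courantElement a b c x + formAct φ.ops (midDefect f x) P a b c := by
  simp only [polyAct_eq_formAct, formAct, monomialSum, Finset.mul_sum, ← Finset.sum_add_distrib]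
  refine Finset.sum_congr rfl fun d _ => ?_
  rw [orderedMonomial_fsmul, courantElement, bracket_fsmul_right, pairing_add_left,
    pairing_smul_left, pairing_smul_left]
  simp only [midDefect, anchorDeriv, courantElement]
  ring

theorem polyAct_fsmul_left (f : C^∞⟮𝓘(ℝ, E), M; ℝ⟯) (P : PolyRing N) (a b c : GSec E M) (x : M) :
    φ.polyAct P courantElement (fsmul f a) b c x =
      f x * φ.polyAct P courantElement a b c x + formAct φ.ops (leftDefect f x) P a b c := by
  simp only [polyAct_eq_formAct, formAct, monomialSum, Finset.mul_sum, ← Finset.sum_add_distrib]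
  refine Finset.sum_congr rfl fun d _ => ?_
  rw [orderedMonomial_fsmul, courantElement, bracket_fsmul_left, pairing_add_left,
    pairing_sub_left, pairing_smul_left, pairing_smul_left, pairing_smul_left, pairing_mk_zero]
  simp only [leftDefect, anchorDeriv, courantElement]
  ring

theorem isTensor_polyAct {P : PolyRing N}
    (hmid : ∀ f x a b c, formAct φ.ops (midDefect f x) P a b c = 0)
    (hleft : ∀ f x a b c, formAct φ.ops (leftDefect f x) P a b c = 0) :
    IsTensor (φ.polyAct P courantElement) where
  add_left a a' b c := by
    funext x
    simp only [Pi.add_apply, polyAct_eq_formAct, formAct, monomialSum, ← Finset.sum_add_distrib,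
      ← mul_add, courantElement, map_add, bracket_add_left, pairing_add_left]
  add_mid a b b' c := by
    funext x
    simp only [Pi.add_apply, polyAct_eq_formAct, formAct, monomialSum, ← Finset.sum_add_distrib,
      ← mul_add, courantElement, map_add, bracket_add_right, pairing_add_left]
  add_right a b c c' := by
    funext x
    simp only [Pi.add_apply, polyAct_eq_formAct, formAct, monomialSum, ← Finset.sum_add_distrib,
      ← mul_add, courantElement, map_add, ← pairing_add_right]
    rfl
  smul_left f a b c x := by rw [polyAct_fsmul_left, hleft, add_zero]
  smul_mid f a b c x := by rw [polyAct_fsmul_mid, hmid, add_zero]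
  smul_right f a b c x := φ.polyAct_fsmul_right f P a b c x

end CommutingFamily

theorem signCast_mul_self (e : ℤˣ) : ((e : ℤ) : ℝ) * ((e : ℤ) : ℝ) = 1 := by
  rcases Int.units_eq_one_or e with rfl | rfl <;> norm_num

/-- The cubic `(xᵢ - εᵢ yᵢ) (yⱼ - εⱼ zⱼ) (z_k - ε_k x_k)`. -/
def crossCubic (ε : Fin N → ℤˣ) (i j k : Fin N) : PolyRing N :=
  (MvPolynomial.X (0, i) - MvPolynomial.C ((ε i : ℤ) : ℝ) * MvPolynomial.X (1, i)) *
    (MvPolynomial.X (1, j) - MvPolynomial.C ((ε j : ℤ) : ℝ) * MvPolynomial.X (2, j)) *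
    (MvPolynomial.X (2, k) - MvPolynomial.C ((ε k : ℤ) : ℝ) * MvPolynomial.X (0, k))

/-- Each term of the two tensoriality defects contains one pairing, and the factor of the cubic
attached to the two paired arguments kills that term by the adjunction relation. -/
theorem crossCubic_mem_universallyTensorial (i j k : Fin N) :
    crossCubic ε i j k ∈ universallyTensorial.{u} N ε := by
  intro E _ _ _ M _ _ _ _ _ φ
  have : CompleteSpace E := FiniteDimensional.complete ℝ E
  have adj : ∀ (i : Fin N) (a b : GSec E M) (x : M),
      pairing (φ.ops i a x) (b x) = ((ε i : ℤ) : ℝ) * pairing (a x) (φ.ops i b x) :=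
    fun i a b x => φ.adjoint i x (a x) (b x)
  refine φ.isTensor_polyAct (fun f x a b c => ?_) fun f x a b c => ?_
  · rw [crossCubic, mul_comm (MvPolynomial.X (0, i) - _), mul_assoc]
    refine formAct_eq_zero_of_swap φ.commute_ops a b c (fun v => ?_) _
    simp only [midDefect, Function.update_self, ne_eq, Fin.reduceEq, not_false_eq_true,
      Function.update_of_ne, adj]
    ring
  · have hsplit : formAct φ.ops (leftDefect f x) (crossCubic ε i j k) a b c =
        formAct φ.ops (fun a b c => anchorDeriv f x c * pairing (a x) (b x))
            (crossCubic ε i j k) a b c -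
          formAct φ.ops (fun a b c => anchorDeriv f x b * pairing (a x) (c x))
            (crossCubic ε i j k) a b c := by
      simp only [formAct, monomialSum, leftDefect, mul_sub, Finset.sum_sub_distrib]
    rw [hsplit, sub_eq_zero]
    trans (0 : ℝ)
    · rw [crossCubic, mul_assoc]
      refine formAct_eq_zero_of_swap φ.commute_ops a b c (fun v => ?_) _
      simp only [Function.update_self, ne_eq, Fin.reduceEq, not_false_eq_true,
        Function.update_of_ne, adj]
      ring
    · rw [crossCubic, mul_comm]
      refine (formAct_eq_zero_of_swap φ.commute_ops a b c (fun v => ?_) _).symm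
      simp only [Function.update_self, ne_eq, Fin.reduceEq, not_false_eq_true,
        Function.update_of_ne, adj]
      linear_combination -(anchorDeriv f x (v 1) * pairing (v 0 x) (φ.ops k (v 2) x)) *
        signCast_mul_self (ε k)

end Defects

/-! ### Constant diagonal families and universally tensorial polynomials -/

section VectorSpaceManifold

variable {E : Type u} [NormedAddCommGroup E] [NormedSpace ℝ E]

/-- Over a vector space the trivializations of the generalized tangent bundle are the identity. -/
theorem trivializationAt_gTan (x y : E) (u : GTan E E y) :
    (trivializationAt (GFib E) (GTan E E) x ⟨y, u⟩).2 = u := by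
  have h1 : (trivializationAt E (TangentSpace 𝓘(ℝ, E)) x ⟨y, u.vec⟩).2 = u.vec := by
    rw [trivializationAt_model_space_apply]
  have h2 : (trivializationAt (E →L[ℝ] ℝ) (Cotangent E E) x ⟨y, u.form⟩).2 = u.form := by
    rw [hom_trivializationAt_apply]
    have hs := TangentBundle.symmL_model_space (𝕜 := ℝ) (F := E) x y
    simp only [ContinuousLinearMap.inCoordinates]
    rw [hs]
    ext v
    simp only [Bundle.Trivial.fiberBundle_trivializationAt',
      Bundle.Trivial.continuousLinearMapAt_trivialization]
    rfl
  exact Prod.ext h1 h2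

/-- The section of the generalized tangent bundle of a vector space with constant value `(v, α)`. -/
def constSection (v : E) (α : E →L[ℝ] ℝ) : GSec E E :=
  ⟨fun _ => ((v, α) : E × (E →L[ℝ] ℝ)), fun x => by
    refine (Bundle.contMDiffAt_section x).2 ?_
    refine (contMDiffAt_const (c := ((v, α) : GFib E))).congr_of_eventuallyEq
      (Filter.Eventually.of_forall fun y => ?_)
    exact trivializationAt_gTan x y _⟩

theorem trivializationAt_gTan_hom (x y : E) (L : GTan E E y →L[ℝ] GTan E E y) :
    (trivializationAt (GFib E →L[ℝ] GFib E) (fun x : E => GTan E E x →L[ℝ] GTan E E x) x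
      ⟨y, L⟩).2 = L := by
  have hb : y ∈ (trivializationAt (GFib E) (GTan E E) x).baseSet := by
    change y ∈ (trivializationAt E (TangentSpace 𝓘(ℝ, E)) x).baseSet ∩
      (trivializationAt (E →L[ℝ] ℝ) (Cotangent E E) x).baseSet
    simp [chartAt_self_eq]
  have h1 : ∀ u : GTan E E y,
      (trivializationAt (GFib E) (GTan E E) x).continuousLinearMapAt ℝ y u = u := fun u => by
    rw [Bundle.Trivialization.continuousLinearMapAt_apply,
      Bundle.Trivialization.linearMapAt_apply, if_pos hb]
    exact trivializationAt_gTan x y u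
  have h2 : ∀ w : GFib E,
      (trivializationAt (GFib E) (GTan E E) x).symmL ℝ y w = w := fun w => by
    rw [← h1 ((trivializationAt (GFib E) (GTan E E) x).symmL ℝ y w)]
    exact Bundle.Trivialization.continuousLinearMapAt_symmL _ hb w
  rw [hom_trivializationAt_apply]
  refine ContinuousLinearMap.ext fun w => ?_
  simp only [ContinuousLinearMap.inCoordinates, ContinuousLinearMap.comp_apply]
  rw [h2]
  exact h1 _

/-- The endomorphism of the generalized tangent bundle of a vector space with constant value `A`. -/
def constEnd (A : GFib E →L[ℝ] GFib E) : GEnd E E :=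
  ⟨fun _ => A, fun x => by
    refine (Bundle.contMDiffAt_section x).2 ?_
    refine (contMDiffAt_const (c := A)).congr_of_eventuallyEq
      (Filter.Eventually.of_forall fun y => ?_)
    exact trivializationAt_gTan_hom x y A⟩

/-- A continuous linear functional as a smooth function. -/
def linearFunction (α : E →L[ℝ] ℝ) : C^∞⟮𝓘(ℝ, E), E; ℝ⟯ := ⟨α, α.contMDiff⟩

theorem anchorDeriv_linearFunction (α β : E →L[ℝ] ℝ) (x v : E) :
    anchorDeriv (linearFunction α) x (constSection v β) = α v := by
  change mfderiv 𝓘(ℝ, E) 𝓘(ℝ, ℝ) α x v = α v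
  rw [mfderiv_eq_fderiv, α.fderiv]
  rfl

theorem pairing_constSection (v w : E) (α β : E →L[ℝ] ℝ) (x : E) :
    pairing (constSection v α x) (constSection w β x) = (α w + β v) / 2 := rfl

variable {N : ℕ}

/-- The family with constant values `Aᵢ ⊕ εᵢ Aᵢᵗ`, for pairwise commuting operators `Aᵢ` of a
vector space. -/
def constFamily (ε : Fin N → ℤˣ) (A : Fin N → E →L[ℝ] E)
    (hA : ∀ i j v, A i (A j v) = A j (A i v)) : CommutingFamily E E N ε where
  toFun i := constEnd ((A i).prodMap
    (((ε i : ℤ) : ℝ) • (ContinuousLinearMap.compL ℝ E E ℝ).flip (A i)))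
  adjoint i x u v := by
    change (((ε i : ℤ) : ℝ) * (u.form (A i v.vec) : ℝ) + (v.form (A i u.vec) : ℝ)) / 2 =
      ((ε i : ℤ) : ℝ) * (((u.form (A i v.vec) : ℝ) +
        ((ε i : ℤ) : ℝ) * (v.form (A i u.vec) : ℝ)) / 2)
    linear_combination -((v.form (A i u.vec) : ℝ) / 2) * signCast_mul_self (ε i)
  comm i j x u := by
    have key : ∀ (β : E →L[ℝ] ℝ) (v : E), ((ε i : ℤ) : ℝ) * (((ε j : ℤ) : ℝ) * β (A j (A i v))) =
        ((ε j : ℤ) : ℝ) * (((ε i : ℤ) : ℝ) * β (A i (A j v))) := fun β v => by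
      rw [hA]
      ring
    exact GTan.ext (hA i j u.vec) (ContinuousLinearMap.ext fun v => key u.form v)

theorem ops_constFamily (ε : Fin N → ℤˣ) (A : Fin N → E →L[ℝ] E)
    (hA : ∀ i j v, A i (A j v) = A j (A i v)) (i : Fin N) (v : E) (α : E →L[ℝ] ℝ) :
    (constFamily ε A hA).ops i (constSection v α) =
      constSection (A i v) (((ε i : ℤ) : ℝ) • α.comp (A i)) := rfl

end VectorSpaceManifold

section NecessaryConditions

variable {N : ℕ} {ε : Fin N → ℤˣ}

/-- The two defects are differences of values of `P • τ_C`, so tensoriality makes them vanish. -/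
theorem formAct_defect_eq_zero {E : Type u} [NormedAddCommGroup E] [NormedSpace ℝ E]
    [FiniteDimensional ℝ E] {M : Type u} [TopologicalSpace M] [T2Space M]
    [SecondCountableTopology M] [ChartedSpace E M] [IsManifold 𝓘(ℝ, E) ∞ M]
    {P : PolyRing N} (hP : P ∈ universallyTensorial.{u} N ε) (φ : CommutingFamily E M N ε)
    (f : C^∞⟮𝓘(ℝ, E), M; ℝ⟯) (x : M) (a b c : GSec E M) :
    formAct φ.ops (midDefect f x) P a b c = 0 ∧ formAct φ.ops (leftDefect f x) P a b c = 0 := by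
  have : CompleteSpace E := FiniteDimensional.complete ℝ E
  have h := hP E M φ
  have h1 := φ.polyAct_fsmul_mid f P a b c x
  have h2 := φ.polyAct_fsmul_left f P a b c x
  rw [h.smul_mid] at h1
  rw [h.smul_left] at h2
  exact ⟨by linarith, by linarith⟩

/-- A universally tensorial polynomial vanishes wherever two of its three arguments `x`, `y`, `z`
are related by the signature. The relations are read off from the tensoriality defects of the
constant family on the plane with eigenvalues `l` and `m` along the two axes. -/
theorem eval_eq_zero_of_mem_universallyTensorial {P : PolyRing N}
    (hP : P ∈ universallyTensorial.{u} N ε) (l m : Fin N → ℝ) :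
    MvPolynomial.eval (triplePoint l m fun i => ((ε i : ℤ) : ℝ) * m i) P = 0 ∧
    MvPolynomial.eval (triplePoint m l fun i => ((ε i : ℤ) : ℝ) * m i) P = 0 ∧
    MvPolynomial.eval (triplePoint m (fun i => ((ε i : ℤ) : ℝ) * m i) l) P = 0 := by
  let E : Type u := ULift.{u} (Fin 2) → ℝ
  let c : ULift.{u} (Fin 2) → Fin N → ℝ := fun q => ![l, m] q.down
  let A : Fin N → E →L[ℝ] E := fun i =>
    ContinuousLinearMap.pi fun q => c q i • ContinuousLinearMap.proj q
  have hA : ∀ i j v, A i (A j v) = A j (A i v) := fun i j v => by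
    funext q
    change c q i * (c q j * v q) = c q j * (c q i * v q)
    ring
  let φ := constFamily ε A hA
  let e : ULift.{u} (Fin 2) → E := fun q => Pi.single q 1
  let p : ULift.{u} (Fin 2) → E →L[ℝ] ℝ := fun q => ContinuousLinearMap.proj q
  -- The coordinate vector fields `v q` and coordinate forms `w q` are joint eigensections, with
  -- eigenvalues `c q` and `ε (c q)`.
  let v : ULift.{u} (Fin 2) → GSec E E := fun q => constSection (e q) 0
  let w : ULift.{u} (Fin 2) → GSec E E := fun q => constSection 0 (p q)
  have hv : ∀ q i, φ.ops i (v q) = c q i • v q := fun q i => by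
    have h1 : A i (e q) = c q i • e q := by
      funext r
      change c r i * (Pi.single q 1 : E) r = c q i * (Pi.single q 1 : E) r
      rcases eq_or_ne r q with rfl | hr
      · rfl
      · rw [Pi.single_eq_of_ne hr, mul_zero, mul_zero]
    rw [show φ.ops i (v q) = _ from ops_constFamily ε A hA i _ _, h1, ContinuousLinearMap.zero_comp,
      smul_zero]
    refine ContMDiffSection.ext fun x => ?_
    exact Prod.ext rfl (smul_zero (A := E →L[ℝ] ℝ) (c q i)).symm
  have hw : ∀ q i, φ.ops i (w q) = (((ε i : ℤ) : ℝ) * c q i) • w q := fun q i => by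
    have h1 : (p q).comp (A i) = c q i • p q := rfl
    rw [show φ.ops i (w q) = _ from ops_constFamily ε A hA i _ _, h1, map_zero, smul_smul]
    refine ContMDiffSection.ext fun x => ?_
    exact Prod.ext (smul_zero (A := E) (((ε i : ℤ) : ℝ) * c q i)).symm rfl
  have hmid : ∀ (f : C^∞⟮𝓘(ℝ, E), E; ℝ⟯) (r s t : ℝ) (a b c : GSec E E),
      midDefect f 0 (r • a) (s • b) (t • c) = r * s * t * midDefect f 0 a b c := by
    intro f r s t a b c
    change anchorDeriv f 0 (r • a) * pairing (s • b 0) (t • c 0) = _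
    rw [anchorDeriv_smul, pairing_smul_left, pairing_smul_right, midDefect]
    ring
  have hleft : ∀ (f : C^∞⟮𝓘(ℝ, E), E; ℝ⟯) (r s t : ℝ) (a b c : GSec E E),
      leftDefect f 0 (r • a) (s • b) (t • c) = r * s * t * leftDefect f 0 a b c := by
    intro f r s t a b c
    change anchorDeriv f 0 (t • c) * pairing (r • a 0) (s • b 0) -
      anchorDeriv f 0 (s • b) * pairing (r • a 0) (t • c 0) = _
    simp only [anchorDeriv_smul, pairing_smul_left, pairing_smul_right, leftDefect]
    ring
  let q0 : ULift.{u} (Fin 2) := ⟨0⟩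
  let q1 : ULift.{u} (Fin 2) := ⟨1⟩
  -- Among the sections used, only `v q0` has an anchor along which `f` has a nonzero derivative.
  let f := linearFunction (p q0)
  have e00 : p q0 (e q0) = 1 := by
    change (Pi.single q0 1 : E) q0 = 1
    rw [Pi.single_eq_same]
  have e11 : p q1 (e q1) = 1 := by
    change (Pi.single q1 1 : E) q1 = 1
    rw [Pi.single_eq_same]
  have key := formAct_defect_eq_zero hP φ f 0
  refine ⟨?_, ?_, ?_⟩
  · have h := (key (v q0) (v q1) (w q1)).1
    rw [formAct_eigenvectors (hmid f) P (hv q0) (hv q1) (hw q1)] at h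
    have hd : midDefect f 0 (v q0) (v q1) (w q1) = 1 / 2 := by
      rw [midDefect, anchorDeriv_linearFunction, pairing_constSection, e00, e11]
      simp
    rw [hd] at h
    exact (mul_eq_zero.1 h).resolve_right (by norm_num)
  · have h := (key (v q1) (v q0) (w q1)).2
    rw [formAct_eigenvectors (hleft f) P (hv q1) (hv q0) (hw q1)] at h
    have hd : leftDefect f 0 (v q1) (v q0) (w q1) = -1 / 2 := by
      rw [leftDefect, anchorDeriv_linearFunction, anchorDeriv_linearFunction, pairing_constSection,
        pairing_constSection, e00, e11]
      simp
      norm_num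
    rw [hd] at h
    exact (mul_eq_zero.1 h).resolve_right (by norm_num)
  · have h := (key (v q1) (w q1) (v q0)).2
    rw [formAct_eigenvectors (hleft f) P (hv q1) (hw q1) (hv q0)] at h
    have hd : leftDefect f 0 (v q1) (w q1) (v q0) = 1 / 2 := by
      rw [leftDefect, anchorDeriv_linearFunction, anchorDeriv_linearFunction, pairing_constSection,
        pairing_constSection, e00, e11]
      simp
    rw [hd] at h
    exact (mul_eq_zero.1 h).resolve_right (by norm_num)

/-- A polynomial vanishing at all real points of a polynomially parametrized set vanishes at its
complex points. -/
theorem aeval_eq_zero_of_forall_real {σ τ : Type*} (P : MvPolynomial σ ℝ)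
    (θ : σ → MvPolynomial τ ℝ)
    (h : ∀ y : τ → ℝ, MvPolynomial.eval (fun s => MvPolynomial.eval y (θ s)) P = 0) (y : τ → ℂ) :
    MvPolynomial.aeval (fun s => MvPolynomial.aeval y (θ s)) P = 0 := by
  have h0 : MvPolynomial.bind₁ θ P = 0 := MvPolynomial.funext fun z => by
    rw [map_zero, ← h z]
    exact MvPolynomial.aeval_bind₁ z θ P
  rw [← MvPolynomial.aeval_bind₁, h0, map_zero]

theorem aeval_eq_zero_of_mem_universallyTensorial {P : PolyRing N}
    (hP : P ∈ universallyTensorial.{u} N ε) (l m : Fin N → ℂ) :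
    MvPolynomial.aeval (triplePoint l m fun i => ((ε i : ℤ) : ℂ) * m i) P = 0 ∧
    MvPolynomial.aeval (triplePoint m l fun i => ((ε i : ℤ) : ℂ) * m i) P = 0 ∧
    MvPolynomial.aeval (triplePoint m (fun i => ((ε i : ℤ) : ℂ) * m i) l) P = 0 := by
  let L : Fin N → MvPolynomial (Fin 2 × Fin N) ℝ := fun i => MvPolynomial.X (0, i)
  let R : Fin N → MvPolynomial (Fin 2 × Fin N) ℝ := fun i => MvPolynomial.X (1, i)
  let S : Fin N → MvPolynomial (Fin 2 × Fin N) ℝ :=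
    fun i => MvPolynomial.C ((ε i : ℤ) : ℝ) * MvPolynomial.X (1, i)
  have push : ∀ {K : Type} (g : MvPolynomial (Fin 2 × Fin N) ℝ → K)
      (a b c : Fin N → MvPolynomial (Fin 2 × Fin N) ℝ) (s : Fin 3 × Fin N),
      g (triplePoint a b c s) =
        triplePoint (fun i => g (a i)) (fun i => g (b i)) (fun i => g (c i)) s := by
    rintro K g a b c ⟨s, i⟩
    fin_cases s <;> rfl
  have real := fun y : Fin 2 × Fin N → ℝ => eval_eq_zero_of_mem_universallyTensorial hP
    (fun i => y (0, i)) fun i => y (1, i)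
  let y : Fin 2 × Fin N → ℂ := fun s => ![l, m] s.1 s.2
  have h1 := aeval_eq_zero_of_forall_real P (triplePoint L R S) (fun y => by
    have := (real y).1
    simp only [push, L, R, S, map_mul, MvPolynomial.eval_X, MvPolynomial.eval_C]
    exact this) y
  have h2 := aeval_eq_zero_of_forall_real P (triplePoint R L S) (fun y => by
    have := (real y).2.1
    simp only [push, L, R, S, map_mul, MvPolynomial.eval_X, MvPolynomial.eval_C]
    exact this) y
  have h3 := aeval_eq_zero_of_forall_real P (triplePoint R S L) (fun y => by
    have := (real y).2.2
    simp only [push, L, R, S, map_mul, MvPolynomial.eval_X, MvPolynomial.eval_C]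
    exact this) y
  simp only [push, L, R, S, map_mul, MvPolynomial.aeval_X, MvPolynomial.aeval_C, y,
    Matrix.cons_val_zero, Matrix.cons_val_one, Complex.coe_algebraMap, Complex.ofReal_intCast]
    at h1 h2 h3
  exact ⟨h1, h2, h3⟩

end NecessaryConditions

/-! ### Complex sections and joint eigenbundles -/

section RealAndImaginaryParts

variable {V : Type*} [AddCommGroup V] [Module ℝ V]

theorem exists_eq_one_tmul_add_I_tmul (w : ℂ ⊗[ℝ] V) :
    ∃ u v : V, w = (1 : ℂ) ⊗ₜ[ℝ] u + Complex.I ⊗ₜ[ℝ] v := by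
  induction w with
  | zero => exact ⟨0, 0, by simp⟩
  | add w w' hw hw' =>
    obtain ⟨u, v, rfl⟩ := hw
    obtain ⟨u', v', rfl⟩ := hw'
    exact ⟨u + u', v + v', by rw [TensorProduct.tmul_add, TensorProduct.tmul_add]; abel⟩
  | tmul z v =>
    refine ⟨z.re • v, z.im • v, ?_⟩
    rw [← TensorProduct.smul_tmul, ← TensorProduct.smul_tmul, ← TensorProduct.add_tmul]
    congr 1
    apply Complex.ext <;> simp

theorem one_tmul_add_I_tmul_eq_zero {u v : V}
    (h : (1 : ℂ) ⊗ₜ[ℝ] u + Complex.I ⊗ₜ[ℝ] v = 0) : u = 0 ∧ v = 0 := by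
  have hre := congrArg (fun w => TensorProduct.lid ℝ V (TensorProduct.map Complex.reLm .id w)) h
  have him := congrArg (fun w => TensorProduct.lid ℝ V (TensorProduct.map Complex.imLm .id w)) h
  constructor
  · simpa using hre
  · simpa using him

theorem apply_aeval_of_intertwines {K U W : Type*} [Field K] [AddCommGroup U] [Module K U]
    [AddCommGroup W] [Module K W] {f : Module.End K U} {g : Module.End K W} {T : U →ₗ[K] W}
    (h : ∀ u, T (f u) = g (T u)) (p : Polynomial K) (u : U) :
    T (Polynomial.aeval f p u) = Polynomial.aeval g p (T u) := by
  have hpow : ∀ n : ℕ, T ((f ^ n) u) = (g ^ n) (T u) := fun n => by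
    induction n with
    | zero => rfl
    | succ n ih => rw [pow_succ', pow_succ', Module.End.mul_apply, Module.End.mul_apply, h, ih]
  simp [Polynomial.aeval_eq_sum_range, hpow]

end RealAndImaginaryParts

section ComplexSections

variable {E : Type u} [NormedAddCommGroup E] [NormedSpace ℝ E]
  {M : Type u} [TopologicalSpace M] [ChartedSpace E M]

/-- The complex bilinear extension of the tautological inner product. -/
def complexPairing (x : M) : CGTan E M x →ₗ[ℂ] CGTan E M x →ₗ[ℂ] ℂ :=
  complexify₂ ((pairingₗ x).compr₂ (Algebra.linearMap ℝ ℂ))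

theorem complexPairing_tmul {x : M} (z w : ℂ) (u v : GTan E M x) :
    complexPairing x (z ⊗ₜ u) (w ⊗ₜ v) = z * w * (pairing u v : ℝ) := by
  simp [complexPairing, mul_assoc]

theorem eq_zero_of_complexPairing_eq_zero {x : M} {u : CGTan E M x}
    (h : ∀ v, complexPairing x u v = 0) : u = 0 := by
  obtain ⟨a, b, rfl⟩ := exists_eq_one_tmul_add_I_tmul u
  have key : ∀ v : GTan E M x, pairing a v = 0 ∧ pairing b v = 0 := fun v => by
    have := h (1 ⊗ₜ v)
    rw [map_add, LinearMap.add_apply, complexPairing_tmul, complexPairing_tmul] at this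
    have hre := congrArg Complex.re this
    have him := congrArg Complex.im this
    simp at hre him
    exact ⟨hre, him⟩
  rw [eq_zero_of_pairing_eq_zero fun v => (key v).1, eq_zero_of_pairing_eq_zero fun v => (key v).2]
  simp

variable [IsManifold 𝓘(ℝ, E) ∞ M]

/-- A smooth complex section as an element of the complexification of the space of smooth real
sections. -/
def CSec.toTensor (s : CSec E M) : ℂ ⊗[ℝ] GSec E M :=
  (1 : ℂ) ⊗ₜ[ℝ] s.re + Complex.I ⊗ₜ[ℝ] s.im

theorem CSec.toTensor_surjective : Function.Surjective (CSec.toTensor (E := E) (M := M)) := by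
  intro w
  obtain ⟨u, v, rfl⟩ := exists_eq_one_tmul_add_I_tmul w
  exact ⟨⟨u, v⟩, rfl⟩

/-- The evaluation at a point on the complexification of the space of smooth sections. -/
def complexEval (x : M) : (ℂ ⊗[ℝ] GSec E M) →ₗ[ℂ] CGTan E M x := (evalₗ x).baseChange ℂ

theorem complexEval_toTensor (s : CSec E M) (x : M) : complexEval x s.toTensor = s.eval x := by
  simp only [complexEval, CSec.toTensor, map_add, LinearMap.baseChange_tmul]
  rfl

theorem eq_zero_of_complexEval_eq_zero {w : ℂ ⊗[ℝ] GSec E M} (h : ∀ x, complexEval x w = 0) :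
    w = 0 := by
  obtain ⟨s, rfl⟩ := CSec.toTensor_surjective w
  have key := fun x => one_tmul_add_I_tmul_eq_zero ((complexEval_toTensor s x).symm.trans (h x))
  have hre : s.re = 0 := ContMDiffSection.ext fun x => (key x).1
  have him : s.im = 0 := ContMDiffSection.ext fun x => (key x).2
  simp [CSec.toTensor, hre, him]

theorem complexEval_surjective [FiniteDimensional ℝ E] [T2Space M] (x : M) :
    Function.Surjective (complexEval (E := E) x) := by
  intro w
  obtain ⟨u, v, rfl⟩ := exists_eq_one_tmul_add_I_tmul w
  obtain ⟨a, rfl⟩ := evalₗ_surjective x u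
  obtain ⟨b, rfl⟩ := evalₗ_surjective x v
  exact ⟨CSec.toTensor ⟨a, b⟩, complexEval_toTensor _ x⟩

section Bracket

variable [CompleteSpace E]

theorem complexify₂_bracketₗ_toTensor (s t : CSec E M) (x : M) :
    complexify₂ ((bracketₗ x).compr₂ (TensorProduct.mk ℝ ℂ (GTan E M x) 1)) s.toTensor t.toTensor =
      cbracket s t x := by
  simp only [CSec.toTensor, map_add, LinearMap.add_apply, complexify₂_tmul, LinearMap.compr₂_apply,
    bracketₗ_apply, TensorProduct.mk_apply, one_smul, cbracket, TensorProduct.smul_tmul',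
    smul_eq_mul, mul_one, Complex.I_mul_I, TensorProduct.neg_tmul, TensorProduct.tmul_add,
    TensorProduct.tmul_sub]
  abel

/-- The form `⟨⟦a, b⟧, c⟩` at a point is obtained from the bilinear maps `⟦a, b⟧(x)` and
`⟨u, c(x)⟩`. -/
theorem complexTrilinear_toTensor (s t : CSec E M) (c : ℂ ⊗[ℝ] GSec E M) (x : M) :
    complexTrilinear (bracketₗ x) ((pairingₗ x).compl₂ (evalₗ x)) s.toTensor t.toTensor c =
      complexPairing x (cbracket s t x) (complexEval x c) := by
  rw [complexTrilinear, complexify₂_bracketₗ_toTensor]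
  generalize cbracket s t x = w
  induction c with
  | zero => simp
  | add c c' hc hc' => rw [map_add, map_add, map_add, hc, hc']
  | tmul z c =>
    induction w using TensorProduct.induction_on with
    | zero => simp
    | add w w' hw hw' =>
      rw [map_add, map_add, LinearMap.add_apply, LinearMap.add_apply, hw, hw']
    | tmul y w => simp [complexPairing, complexEval]

end Bracket

variable {N : ℕ} {ε : Fin N → ℤˣ}

namespace CommutingFamily

variable (φ : CommutingFamily E M N ε)

theorem mem_jointEigen {φ : CommutingFamily E M N ε} {l : Fin N → ℂ} {x : M} {u : CGTan E M x} :
    u ∈ φ.jointEigen l x ↔ ∀ i, φ.complexify i x u = l i • u := by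
  simp only [jointEigen, Submodule.mem_iInf, Module.End.mem_eigenspace_iff]

theorem complexEval_ops (i : Fin N) (x : M) (w : ℂ ⊗[ℝ] GSec E M) :
    complexEval x ((φ.ops i).baseChange ℂ w) = φ.complexify i x (complexEval x w) := by
  induction w with
  | zero => simp
  | add w w' hw hw' => rw [map_add, map_add, hw, hw', map_add, map_add]
  | tmul z a => rfl

theorem ops_toTensor_iff {l : Fin N → ℂ} {s : CSec E M} :
    (∀ i, (φ.ops i).baseChange ℂ s.toTensor = l i • s.toTensor) ↔
      s ∈ sectionsOf (φ.jointEigen l) := by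
  constructor
  · intro h x
    rw [mem_jointEigen]
    intro i
    rw [← complexEval_toTensor, ← complexEval_ops, h, map_smul]
  · intro h i
    rw [← sub_eq_zero]
    refine eq_zero_of_complexEval_eq_zero fun x => ?_
    rw [map_sub, complexEval_ops, map_smul, complexEval_toTensor, mem_jointEigen.1 (h x) i,
      sub_self]

theorem complexify_comm (i j : Fin N) (x : M) (u : CGTan E M x) :
    φ.complexify i x (φ.complexify j x u) = φ.complexify j x (φ.complexify i x u) := by
  induction u using TensorProduct.induction_on with
  | zero => simp
  | add u u' hu hu' => simp only [map_add, hu, hu']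
  | tmul z u => exact congrArg (z ⊗ₜ[ℝ] ·) (φ.comm i j x u)

theorem complexPairing_complexify (i : Fin N) (x : M) (u v : CGTan E M x) :
    complexPairing x (φ.complexify i x u) v =
      ((ε i : ℤ) : ℂ) * complexPairing x u (φ.complexify i x v) := by
  induction u using TensorProduct.induction_on with
  | zero => simp
  | add u u' hu hu' => simp only [map_add, LinearMap.add_apply, hu, hu', mul_add]
  | tmul z u =>
    induction v using TensorProduct.induction_on with
    | zero => simp
    | add v v' hv hv' => simp only [map_add, hv, hv', mul_add]
    | tmul w v =>
      have h := congrArg (fun r : ℝ => (r : ℂ)) (φ.adjoint i x u v)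
      change complexPairing x (z ⊗ₜ φ.toFun i x u) (w ⊗ₜ v) =
        _ * complexPairing x (z ⊗ₜ u) (w ⊗ₜ φ.toFun i x v)
      rw [complexPairing_tmul, complexPairing_tmul]
      simp only [Complex.ofReal_mul, Complex.ofReal_intCast] at h
      rw [h]
      ring

theorem complexPairing_eq_zero_of_ne {l m : Fin N → ℂ} {x : M} {u v : CGTan E M x}
    (hu : u ∈ φ.jointEigen l x) (hv : v ∈ φ.jointEigen m x)
    (h : l ≠ fun i => ((ε i : ℤ) : ℂ) * m i) : complexPairing x u v = 0 := by
  obtain ⟨i, hi⟩ := Function.ne_iff.1 h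
  have key := φ.complexPairing_complexify i x u v
  rw [mem_jointEigen.1 hu, mem_jointEigen.1 hv, map_smul, LinearMap.smul_apply, map_smul,
    smul_eq_mul, smul_eq_mul, ← mul_assoc, ← sub_eq_zero, ← sub_mul] at key
  exact (mul_eq_zero.1 key).resolve_left (sub_ne_zero.2 hi)

variable {φ}

theorem IsSemisimple.iSup_jointEigen (hφ : φ.IsSemisimple) (x : M) :
    ⨆ l, φ.jointEigen l x = ⊤ :=
  iSup_iInf_eigenspace_eq_top (fun i j u => φ.complexify_comm i j x u) fun i => by
    obtain ⟨S, hS⟩ := hφ i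
    exact ⟨S, aeval_prod_X_sub_C_of_isInternal (hS x)⟩

/-- The polynomial in `φᵢ` that vanishes on every fibre does not depend on the fibre, so that the
decomposition into joint eigenbundles decomposes smooth sections into smooth sections. -/
theorem IsSemisimple.iSup_eigenspace_ops (hφ : φ.IsSemisimple) :
    ⨆ χ : Fin N → ℂ, ⨅ i, Module.End.eigenspace ((φ.ops i).baseChange ℂ) (χ i) = ⊤ := by
  refine iSup_iInf_eigenspace_eq_top (fun i j w => ?_) fun i => ?_
  · rw [← LinearMap.comp_apply, ← LinearMap.comp_apply, ← LinearMap.baseChange_comp,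
      ← LinearMap.baseChange_comp]
    exact congrArg (fun g : Module.End ℝ (GSec E M) => g.baseChange ℂ w) (φ.commute_ops i j).eq
  · obtain ⟨S, hS⟩ := hφ i
    refine ⟨S, LinearMap.ext fun w => eq_zero_of_complexEval_eq_zero fun x => ?_⟩
    rw [apply_aeval_of_intertwines (g := φ.complexify i x) (φ.complexEval_ops i x),
      aeval_prod_X_sub_C_of_isInternal (hS x)]
    rfl

end CommutingFamily

end ComplexSections

/-! ### Uniform integrability in terms of joint eigenbundles -/

section Integrability

variable {E : Type u} [NormedAddCommGroup E] [NormedSpace ℝ E]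
  {M : Type u} [TopologicalSpace M] [ChartedSpace E M]
  [IsManifold 𝓘(ℝ, E) ∞ M] {N : ℕ} {ε : Fin N → ℤˣ} {φ : CommutingFamily E M N ε}

theorem signCast_mul_cancel (e : ℤˣ) (z : ℂ) : ((e : ℤ) : ℂ) * (((e : ℤ) : ℂ) * z) = z := by
  rcases Int.units_eq_one_or e with rfl | rfl <;> simp

theorem sign_mul_eq_iff {l m : Fin N → ℂ} :
    (l = fun i => ((ε i : ℤ) : ℂ) * m i) ↔ m = fun i => ((ε i : ℤ) : ℂ) * l i := by
  constructor <;> rintro rfl <;> funext i <;> simp [signCast_mul_cancel]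

theorem norm_sub_sign_mul_eq_zero_iff {l m : Fin N → ℂ} :
    ‖(WithLp.toLp 2 (fun i => l i - ((ε i : ℤ) : ℂ) * m i) : EuclideanSpace ℂ (Fin N))‖ = 0 ↔
      l = fun i => ((ε i : ℤ) : ℂ) * m i := by
  rw [norm_eq_zero]
  constructor
  · intro h
    funext i
    have := congrArg (fun v : EuclideanSpace ℂ (Fin N) => v i) h
    exact sub_eq_zero.1 this
  · intro h
    ext i
    change l i - ((ε i : ℤ) : ℂ) * m i = 0
    rw [h, sub_self]

theorem CommutingFamily.jointEigen_sup_le_detSum (l m : Fin N → ℂ) (x : M) :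
    φ.jointEigen l x ⊔ φ.jointEigen m x ≤ φ.detSum l m x := by
  refine sup_le ?_ ?_
  · refine le_iSup_of_le ⟨l, fun i j _ _ => ?_⟩ le_rfl
    simp [Matrix.det_fin_three]
    ring
  · refine le_iSup_of_le ⟨m, fun i j _ _ => ?_⟩ le_rfl
    simp [Matrix.det_fin_three]
    ring

/-- If `l` and `m` are related by the signature, the first two rows of the determinants coincide,
and the determinant condition is empty. -/
theorem CommutingFamily.IsSemisimple.detSum_eq_top (hφ : φ.IsSemisimple) {l m : Fin N → ℂ}
    (hlm : l = fun i => ((ε i : ℤ) : ℂ) * m i) (x : M) : φ.detSum l m x = ⊤ := by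
  rw [eq_top_iff, ← hφ.iSup_jointEigen x]
  refine iSup_le fun k => le_iSup_of_le ⟨k, fun i j hi hj => ?_⟩ le_rfl
  have hl : ∀ i, ε i = 1 → l i = m i := fun i hi => by simp [hlm, hi]
  rw [hl i hi, hl j hj, Matrix.det_fin_three]
  simp
  ring

variable [FiniteDimensional ℝ E]

/-- The joint eigenvalues of three sections whose Courant element does not vanish satisfy one of the
three relations defining universally tensorial polynomials. -/
theorem CommutingFamily.UniformlyIntegrable.complexPairing_cbracket
    (h : φ.UniformlyIntegrable) {l m n : Fin N → ℂ} {s t : CSec E M}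
    (hs : s ∈ sectionsOf (φ.jointEigen l)) (ht : t ∈ sectionsOf (φ.jointEigen m))
    {c : ℂ ⊗[ℝ] GSec E M} (hc : ∀ i, (φ.ops i).baseChange ℂ c = n i • c)
    (hlm : l ≠ fun i => ((ε i : ℤ) : ℂ) * m i) (hmn : m ≠ fun i => ((ε i : ℤ) : ℂ) * n i)
    (hnl : n ≠ fun i => ((ε i : ℤ) : ℂ) * l i) (x : M) :
    complexPairing x (cbracket s t x) (complexEval x c) = 0 := by
  have : CompleteSpace E := FiniteDimensional.complete ℝ E
  obtain ⟨i, hi⟩ := Function.ne_iff.1 hlm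
  obtain ⟨j, hj⟩ := Function.ne_iff.1 hmn
  obtain ⟨k, hk⟩ := Function.ne_iff.1 hnl
  have h0 := complexPolyAct_eq_zero (B := bracketₗ x) (h := (pairingₗ x).compl₂ (evalₗ x))
    (f := φ.ops) (fun a b c => h (crossCubic_mem_universallyTensorial i j k) a b c x)
    s.toTensor t.toTensor c
  rw [complexPolyAct_eigenvectors _ (φ.ops_toTensor_iff.2 hs) (φ.ops_toTensor_iff.2 ht) hc,
    complexTrilinear_toTensor] at h0
  refine (mul_eq_zero.1 h0).resolve_left ?_
  simp only [crossCubic, map_mul, map_sub, MvPolynomial.aeval_X, MvPolynomial.aeval_C, triplePoint,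
    Matrix.cons_val, Complex.coe_algebraMap, Complex.ofReal_intCast]
  exact mul_ne_zero (mul_ne_zero (sub_ne_zero.2 hi) (sub_ne_zero.2 hj)) (sub_ne_zero.2 hk)

/-- The components of the bracket in the other joint eigenbundles are orthogonal to every joint
eigensection, hence vanish by nondegeneracy of the pairing. -/
theorem CommutingFamily.UniformlyIntegrable.cbracket_mem [T2Space M] (h : φ.UniformlyIntegrable)
    (hφ : φ.IsSemisimple) {l m : Fin N → ℂ} {s t : CSec E M}
    (hs : s ∈ sectionsOf (φ.jointEigen l)) (ht : t ∈ sectionsOf (φ.jointEigen m))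
    (hlm : l ≠ fun i => ((ε i : ℤ) : ℂ) * m i) (x : M) :
    cbracket s t x ∈ φ.jointEigen l x ⊔ φ.jointEigen m x := by
  have hw : cbracket s t x ∈ ⨆ k, φ.jointEigen k x := by rw [hφ.iSup_jointEigen]; trivial
  obtain ⟨f, hf, hsum⟩ := (Submodule.mem_iSup_iff_exists_finsupp _ _).1 hw
  have hzero : ∀ k, k ≠ l → k ≠ m → f k = 0 := by
    intro k hkl hkm
    refine eq_zero_of_complexPairing_eq_zero fun v => ?_
    obtain ⟨c, rfl⟩ := complexEval_surjective x v
    have hc : c ∈ ⨆ χ : Fin N → ℂ, ⨅ i, Module.End.eigenspace ((φ.ops i).baseChange ℂ) (χ i) := by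
      rw [hφ.iSup_eigenspace_ops]; trivial
    refine Submodule.iSup_induction _
      (motive := fun c => complexPairing x (f k) (complexEval x c) = 0) hc (fun n c hc => ?_)
      (by simp) fun c c' hc hc' => by rw [map_add, map_add, hc, hc', add_zero]
    simp only [Submodule.mem_iInf, Module.End.mem_eigenspace_iff] at hc
    have hcx : complexEval x c ∈ φ.jointEigen n x := mem_jointEigen.2 fun i => by
      rw [← complexEval_ops, hc, map_smul]
    by_cases hkn : k = fun i => ((ε i : ℤ) : ℂ) * n i
    · -- The other components are orthogonal to `c(x)`, so that `⟨f k, c⟩ = ⟨⟦s, t⟧, c⟩`.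
      have h1 : complexPairing x (cbracket s t x) (complexEval x c) =
          complexPairing x (f k) (complexEval x c) := by
        rw [← hsum, Finsupp.sum, map_sum, LinearMap.sum_apply]
        refine Finset.sum_eq_single k (fun k' _ hk' => ?_) fun hk => ?_
        · exact φ.complexPairing_eq_zero_of_ne (hf k') hcx (hkn ▸ hk')
        · rw [Finsupp.notMem_support_iff.1 hk, map_zero, LinearMap.zero_apply]
      rw [← h1]
      refine h.complexPairing_cbracket hs ht hc hlm (fun hmn => hkm (hkn.trans hmn.symm))
        (fun hnl => hkl (hkn.trans (sign_mul_eq_iff.1 hnl).symm)) x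
    · exact φ.complexPairing_eq_zero_of_ne (hf k) hcx hkn
  rw [← hsum]
  refine Submodule.sum_mem _ fun k _ => ?_
  by_cases hkl : k = l
  · exact Submodule.mem_sup_left (hkl ▸ hf k)
  by_cases hkm : k = m
  · exact Submodule.mem_sup_right (hkm ▸ hf k)
  rw [hzero k hkl hkm]
  exact Submodule.zero_mem _

theorem CommutingFamily.IsSemisimple.uniformlyIntegrable (hφ : φ.IsSemisimple)
    (h : ∀ l m : Fin N → ℂ, l ≠ (fun i => ((ε i : ℤ) : ℂ) * m i) →
      ∀ s ∈ sectionsOf (φ.jointEigen l), ∀ t ∈ sectionsOf (φ.jointEigen m), ∀ x : M,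
        cbracket s t x ∈ φ.jointEigen l x ⊔ φ.jointEigen m x) : φ.UniformlyIntegrable := by
  have : CompleteSpace E := FiniteDimensional.complete ℝ E
  intro P hP a b c x
  refine monomialSum_eq_zero_of_eigenvectors (B := bracketₗ x)
    (h := (pairingₗ x).compl₂ (evalₗ x)) (f := φ.ops) hφ.iSup_eigenspace_ops
    (fun l m n a b c ha hb hc => ?_) a b c
  obtain ⟨s, rfl⟩ := CSec.toTensor_surjective a
  obtain ⟨t, rfl⟩ := CSec.toTensor_surjective b
  rw [complexTrilinear_toTensor]
  by_cases hmn : n = fun i => ((ε i : ℤ) : ℂ) * m i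
  · rw [hmn, (aeval_eq_zero_of_mem_universallyTensorial hP l m).1, zero_mul]
  by_cases hln : n = fun i => ((ε i : ℤ) : ℂ) * l i
  · rw [hln, (aeval_eq_zero_of_mem_universallyTensorial hP m l).2.1, zero_mul]
  by_cases hlm : m = fun i => ((ε i : ℤ) : ℂ) * l i
  · rw [hlm, (aeval_eq_zero_of_mem_universallyTensorial hP n l).2.2, zero_mul]
  have hcx : complexEval x c ∈ φ.jointEigen n x := mem_jointEigen.2 fun i => by
    rw [← complexEval_ops, hc, map_smul]
  obtain ⟨u, hu, v, hv, huv⟩ := Submodule.mem_sup.1 (h l m (fun h => hlm (sign_mul_eq_iff.1 h))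
    s (φ.ops_toTensor_iff.1 ha) t (φ.ops_toTensor_iff.1 hb) x)
  rw [← huv, map_add, LinearMap.add_apply,
    φ.complexPairing_eq_zero_of_ne hu hcx fun h => hln (sign_mul_eq_iff.1 h),
    φ.complexPairing_eq_zero_of_ne hv hcx fun h => hmn (sign_mul_eq_iff.1 h), add_zero, mul_zero]

end Integrability

end GenTangent
end

theorem mainTheorem3
    (E : Type u) [NormedAddCommGroup E] [NormedSpace ℝ E] [FiniteDimensional ℝ E]
    (M : Type u) [TopologicalSpace M] [T2Space M] [SecondCountableTopology M]
    [ChartedSpace E M] [IsManifold 𝓘(ℝ, E) ∞ M]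
    (N : ℕ) (ε : Fin N → ℤˣ) (φ : GenTangent.CommutingFamily E M N ε) (hφ : φ.IsSemisimple) :
    φ.UniformlyIntegrable ↔
      ∀ l m : Fin N → ℂ,
        (∀ s ∈ GenTangent.sectionsOf (φ.jointEigen l), ∀ t ∈ GenTangent.sectionsOf (φ.jointEigen m),
          ∀ x : M, ((‖(WithLp.toLp 2 (fun i => l i - ((ε i : ℤ) : ℂ) * m i) :
              EuclideanSpace ℂ (Fin N))‖ : ℝ) : ℂ) • GenTangent.cbracket s t x ∈
            φ.jointEigen l x ⊔ φ.jointEigen m x) ∧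
        (∀ s ∈ GenTangent.sectionsOf (φ.jointEigen l), ∀ t ∈ GenTangent.sectionsOf (φ.jointEigen m),
          ∀ x : M, GenTangent.cbracket s t x ∈ φ.detSum l m x) := by
  constructor
  · intro h l m
    by_cases hlm : l = fun i => ((ε i : ℤ) : ℂ) * m i
    · refine ⟨fun s _ t _ x => ?_, fun s _ t _ x => ?_⟩
      · rw [GenTangent.norm_sub_sign_mul_eq_zero_iff.2 hlm, Complex.ofReal_zero, zero_smul]
        exact Submodule.zero_mem _
      · rw [hφ.detSum_eq_top hlm]
        trivial
    · exact ⟨fun s hs t ht x => Submodule.smul_mem _ _ (h.cbracket_mem hφ hs ht hlm x),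
        fun s hs t ht x => GenTangent.CommutingFamily.jointEigen_sup_le_detSum l m x
          (h.cbracket_mem hφ hs ht hlm x)⟩
  · intro h
    refine hφ.uniformlyIntegrable fun l m hlm s hs t ht x => ?_
    have hne := mt GenTangent.norm_sub_sign_mul_eq_zero_iff.1 hlm
    exact (Submodule.smul_mem_iff _ (Complex.ofReal_ne_zero.2 hne)).1 ((h l m).1 s hs t ht x)
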